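/- Let $E=(E^0,E^1,r,s)$ be a directed graph with $E^0,E^1$ countable; $v\in E^0$ is regular if $r^{-1}(v)$ is finite and non-empty. Let $E^*$ be the set of finite paths $\lambda=e_1\cdots e_n$, $s(e_k)=r(e_{k+1})$, with $r(\lambda)=r(e_1)$, $s(\lambda)=s(e_n)$ (vertices are the paths of length $0$). Let $C^*(E)$ be the graph $C^*$-algebra, universal for families of mutually orthogonal projections $p_v$ ($v\in E^0$) and partial isometries $s_e$ ($e\in E^1$) with mutually orthogonal range projections such that $s_e^*s_e=p_{s(e)}$, $s_es_e^*\le p_{r(e)}$, and $p_v=\sum_{r(e)=v}s_es_e^*$ for regular $v$. Put $s_\lambda=s_{e_1}\cdots s_{e_n}$ ($s_v=p_v$), $p_\lambda=s_\lambda s_\lambda^*$, $q_V=\sum_{v\in V}p_v$ for finite $V\subset E^0$. Let $\mathcal D(E)\subset C^*(E)$ be the $C^*$-subalgebra generated by all $p_\lambda$, and let $\mathcal D(E)_{\rm fin}=\bigcup_V\mathcal D(E)q_V$, the union being over the finite subsets $V$ of $E^0$. A graph trace is a function $g:E^0\to[0,\infty)$ with $g(v)\ge\sum_{r(e)=v}g(s(e))$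 for all $v$, with equality for regular $v$; put $\|g\|_1=\sum_v g(v)\in[0,\infty]$. Let $T(E)$ be the set of graph traces and $T_1(E)=\{g\in T(E):\|g\|_1=1\}$. A state $\phi$ on $\mathcal D(E)$ (a positive linear functional of norm $1$) is fully invariant if $\phi(nbn^*)=\phi(n^*nb)$ for all $b\in\mathcal D(E)$ and all $n\in C^*(E)$ with $n\mathcal D(E)n^*\cup n^*\mathcal D(E)n\subset\mathcal D(E)$; $S^{\rm inv}(\mathcal D(E))$ is the set of these states. **Theorem.** (1) For every $g\in T(E)$ there is a unique positive linear functional $\eta_g:\mathcal D(E)_{\rm fin}\to\mathbb C$ with $\eta_g(p_\lambda)=g(s(\lambda))$ for all $\lambda\in E^*$. For every finite $V\subset E^0$ its restriction to $\mathcal D(E)q_V$ has norm $\sum_{v\in V}g(v)$. The functional $\eta_g$ is norm-continuous if and only if $\|g\|_1<\infty$, and then $\|\eta_g\|=\|g\|_1$. (2) For every $g\in T_1(E)$ there is a unique state $\psi_g$ on $\mathcal D(E)$ with $\psi_g(p_\lambda)=g(s(\lambda))$ for all $\lambda\in E^*$; it extends $\eta_g$ and is fully invariant. The set $T_1(E)$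 is convex, and $g\mapsto\psi_g$ is an affine bijection of $T_1(E)$ onto $S^{\rm inv}(\mathcal D(E))$, whose inverse sends $\theta$ to the function $g^\theta(v)=\theta(p_v)$. -/

import Mathlib

open scoped ENNReal NNReal ComplexOrder

universe u v w

noncomputable section

/-- A directed graph with vertex set `V`, edge set `Ed`, and range and source maps `r`, `s`
(countability of `V` and `Ed` is assumed separately, by type class arguments). -/
structure DirectedGraph (V : Type u) (Ed : Type v) where
  r : Ed → V
  s : Ed → V

namespace DirectedGraph

variable {V : Type u} {Ed : Type v}

/-- A vertex is regular if it receives at least one and only finitely many edges. -/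
def IsRegular (E : DirectedGraph V Ed) (x : V) : Prop :=
  {e | E.r e = x}.Finite ∧ {e | E.r e = x}.Nonempty

/-- `e₁ e₂ … eₙ` is a path with range `x`: `r(e₁) = x` and `s(eₖ) = r(eₖ₊₁)`. -/
def IsPathFrom (E : DirectedGraph V Ed) : V → List Ed → Prop
  | _, [] => True
  | x, e :: l => E.r e = x ∧ E.IsPathFrom (E.s e) l

/-- The source of the path `e₁ … eₙ` with range `x`: it is `s(eₙ)`, or `x` if `n = 0`. -/
def listSource (E : DirectedGraph V Ed) : V → List Ed → V
  | x, [] => x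
  | _, e :: l => E.listSource (E.s e) l

/-- A finite path, an element of `E^*`. The paths of length zero are the vertices. -/
structure FinPath (E : DirectedGraph V Ed) where
  range : V
  edges : List Ed
  isPath : E.IsPathFrom range edges

/-- The source `s(α)` of a finite path. -/
def FinPath.source {E : DirectedGraph V Ed} (α : E.FinPath) : V :=
  E.listSource α.range α.edges

/-- A vertex, regarded as a path of length zero. -/
def vertexPath (E : DirectedGraph V Ed) (x : V) : E.FinPath := ⟨x, [], trivial⟩

/-! ### Cuntz–Krieger families -/

/-- A Cuntz–Krieger `E`-family in a C⋆-algebra. For projections `p`, `q` the inequality `p ≤ q`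
is written as `q * p = p`. -/
structure CKFamily (E : DirectedGraph V Ed) (B : Type w) [NonUnitalCStarAlgebra B] where
  S : Ed → B
  P : V → B
  isStarProjection_P : ∀ x, IsStarProjection (P x)
  P_orthogonal : ∀ x y, x ≠ y → P x * P y = 0
  S_partialIsometry : ∀ e, S e * star (S e) * S e = S e
  S_orthogonal : ∀ e f, e ≠ f → (S e * star (S e)) * (S f * star (S f)) = 0
  star_S_mul_S : ∀ e, star (S e) * S e = P (E.s e)
  range_le : ∀ e, P (E.r e) * (S e * star (S e)) = S e * star (S e)
  P_eq_sum : ∀ x (h : E.IsRegular x), P x = ∑ e ∈ h.1.toFinset, S e * star (S e)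

namespace CKFamily

variable {E : DirectedGraph V Ed} {B : Type w} [NonUnitalCStarAlgebra B]

/-- `S_{e₁} … S_{eₙ}` (as `S_e = S_e P_{s(e)}`, the trailing vertex projection only matters for
paths of length zero, for which the value is `P_x`). -/
def listS (F : CKFamily E B) : V → List Ed → B
  | x, [] => F.P x
  | _, e :: l => F.S e * F.listS (E.s e) l

/-- The partial isometry `S_α` of a finite path `α`. -/
def pathS (F : CKFamily E B) (α : E.FinPath) : B := F.listS α.range α.edges

/-- The range projection `P_α = S_α S_α^*` of a finite path `α`. -/
def pathP (F : CKFamily E B) (α : E.FinPath) : B := F.pathS α * star (F.pathS α)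

/-- The projection `∑_{x ∈ W} P_x`, for a finite set `W` of vertices. -/
def sumP (F : CKFamily E B) (W : Finset V) : B := ∑ x ∈ W, F.P x

theorem pathP_vertexPath (F : CKFamily E B) (x : V) : F.pathP (E.vertexPath x) = F.P x := by
  have h := F.isStarProjection_P x
  change F.P x * star (F.P x) = F.P x
  rw [h.isSelfAdjoint.star_eq, h.isIdempotentElem.eq]

theorem P_mul_S (F : CKFamily E B) (e : Ed) : F.P (E.r e) * F.S e = F.S e := by
  have h := congrArg (· * F.S e) (F.range_le e)
  simp only [mul_assoc] at h
  rw [← mul_assoc (F.S e), F.S_partialIsometry] at h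
  exact h

theorem S_mul_P (F : CKFamily E B) (e : Ed) : F.S e * F.P (E.s e) = F.S e := by
  rw [← F.star_S_mul_S, ← mul_assoc, F.S_partialIsometry]

theorem P_mul_pathS (F : CKFamily E B) (α : E.FinPath) :
    F.P α.range * F.pathS α = F.pathS α := by
  obtain ⟨x, l, h⟩ := α
  cases l with
  | nil => exact (F.isStarProjection_P x).isIdempotentElem.eq
  | cons e l =>
    obtain ⟨rfl, -⟩ := h
    change F.P (E.r e) * (F.S e * F.listS (E.s e) l) = F.S e * F.listS (E.s e) l
    rw [← mul_assoc, F.P_mul_S]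

theorem P_mul_pathP (F : CKFamily E B) (α : E.FinPath) :
    F.P α.range * F.pathP α = F.pathP α := by
  rw [pathP, ← mul_assoc, F.P_mul_pathS]

theorem pathP_mul_P (F : CKFamily E B) (α : E.FinPath) :
    F.pathP α * F.P α.range = F.pathP α := by
  have h := congrArg star (F.P_mul_pathP α)
  simpa [pathP, (F.isStarProjection_P α.range).isSelfAdjoint.star_eq] using h

theorem commute_P_pathP (F : CKFamily E B) (x : V) (α : E.FinPath) :
    F.P x * F.pathP α = F.pathP α * F.P x := by
  by_cases hx : x = α.range
  · rw [hx, F.P_mul_pathP, F.pathP_mul_P]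
  · rw [← F.P_mul_pathP, ← mul_assoc, F.P_orthogonal _ _ hx, F.P_mul_pathP, zero_mul,
      ← F.pathP_mul_P, mul_assoc, F.P_orthogonal _ _ (Ne.symm hx), mul_zero]

theorem sumP_mul_sumP (F : CKFamily E B) {W W' : Finset V} (h : W ⊆ W') :
    F.sumP W * F.sumP W' = F.sumP W := by
  rw [sumP, sumP, Finset.sum_mul]
  refine Finset.sum_congr rfl fun x hx => ?_
  rw [Finset.mul_sum, Finset.sum_eq_single x]
  · exact (F.isStarProjection_P x).isIdempotentElem.eq
  · exact fun y _ hy => F.P_orthogonal _ _ (Ne.symm hy)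
  · exact fun hx' => absurd (h hx) hx'

theorem star_sumP (F : CKFamily E B) (W : Finset V) : star (F.sumP W) = F.sumP W := by
  rw [sumP, star_sum]
  exact Finset.sum_congr rfl fun x _ => (F.isStarProjection_P x).isSelfAdjoint.star_eq

theorem norm_P_le (F : CKFamily E B) (x : V) : ‖F.P x‖ ≤ 1 := by
  have h := F.isStarProjection_P x
  have h1 : ‖F.P x‖ = ‖F.P x‖ * ‖F.P x‖ := by
    rw [← CStarRing.norm_star_mul_self, h.isSelfAdjoint.star_eq, h.isIdempotentElem.eq]
  nlinarith [norm_nonneg (F.P x)]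

theorem norm_S_le (F : CKFamily E B) (e : Ed) : ‖F.S e‖ ≤ 1 := by
  have h1 : ‖F.S e‖ * ‖F.S e‖ ≤ 1 := by
    rw [← CStarRing.norm_star_mul_self, F.star_S_mul_S]
    exact F.norm_P_le _
  nlinarith [norm_nonneg (F.S e)]

end CKFamily

/-! ### The graph C⋆-algebra

It is built as the C⋆-algebra generated by the direct sum of all Cuntz–Krieger families, inside the
bounded product of the C⋆-algebras that carry them. -/

/-- A C⋆-algebra together with a Cuntz–Krieger `E`-family in it. -/
structure CKRep (E : DirectedGraph V Ed) where
  Alg : Type (max u v)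
  [inst : NonUnitalCStarAlgebra Alg]
  fam : CKFamily E Alg

attribute [instance] CKRep.inst

/-- The C⋆-algebra of norm-bounded functions `ρ ↦ a_ρ ∈ ρ.Alg` on all Cuntz–Krieger families. -/
abbrev CKProd (E : DirectedGraph V Ed) := lp (fun ρ : E.CKRep => ρ.Alg) ∞

/-- `e ↦ (S_e)_ρ`, over all Cuntz–Krieger families `ρ`. -/
def prodS (E : DirectedGraph V Ed) (e : Ed) : E.CKProd :=
  ⟨fun ρ => ρ.fam.S e, memℓp_infty ⟨1, by rintro _ ⟨ρ, rfl⟩; exact ρ.fam.norm_S_le e⟩⟩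

/-- `x ↦ (P_x)_ρ`, over all Cuntz–Krieger families `ρ`. -/
def prodP (E : DirectedGraph V Ed) (x : V) : E.CKProd :=
  ⟨fun ρ => ρ.fam.P x, memℓp_infty ⟨1, by rintro _ ⟨ρ, rfl⟩; exact ρ.fam.norm_P_le x⟩⟩

/-- The closed `⋆`-subalgebra generated by all `(S_e)_ρ` and `(P_x)_ρ`. -/
def graphSubalgebra (E : DirectedGraph V Ed) : NonUnitalStarSubalgebra ℂ E.CKProd :=
  (NonUnitalStarAlgebra.adjoin ℂ (Set.range E.prodS ∪ Set.range E.prodP)).topologicalClosure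

/-- The graph C⋆-algebra `C^*(E)`. -/
def GraphCStar (E : DirectedGraph V Ed) : Type _ := E.graphSubalgebra

instance instGraphCStar (E : DirectedGraph V Ed) : NonUnitalCStarAlgebra E.GraphCStar :=
  NonUnitalStarSubalgebra.nonUnitalCStarAlgebra E.graphSubalgebra
    (h_closed := NonUnitalStarSubalgebra.isClosed_topologicalClosure _)

theorem prodS_mem (E : DirectedGraph V Ed) (e : Ed) : E.prodS e ∈ E.graphSubalgebra :=
  NonUnitalStarSubalgebra.le_topologicalClosure _
    (NonUnitalStarAlgebra.subset_adjoin ℂ _ (Or.inl ⟨e, rfl⟩))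

theorem prodP_mem (E : DirectedGraph V Ed) (x : V) : E.prodP x ∈ E.graphSubalgebra :=
  NonUnitalStarSubalgebra.le_topologicalClosure _
    (NonUnitalStarAlgebra.subset_adjoin ℂ _ (Or.inr ⟨x, rfl⟩))

/-- The inclusion of `C^*(E)` into the product. -/
def graphIncl (E : DirectedGraph V Ed) : E.GraphCStar →⋆ₙₐ[ℂ] E.CKProd :=
  NonUnitalStarSubalgebraClass.subtype E.graphSubalgebra

/-- The component of `C^*(E)` at a Cuntz–Krieger family. -/
def graphEval (E : DirectedGraph V Ed) (ρ : E.CKRep) : E.GraphCStar →⋆ₙₐ[ℂ] ρ.Alg where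
  toFun a := (E.graphIncl a : E.CKProd) ρ
  map_smul' _ _ := rfl
  map_zero' := rfl
  map_add' _ _ := rfl
  map_mul' _ _ := rfl
  map_star' _ := rfl

theorem graphCStar_ext (E : DirectedGraph V Ed) {a b : E.GraphCStar}
    (h : ∀ ρ, E.graphEval ρ a = E.graphEval ρ b) : a = b :=
  Subtype.ext (Subtype.ext (funext h))

/-- The universal Cuntz–Krieger family `{s_e, p_x}` in `C^*(E)`. -/
def univ (E : DirectedGraph V Ed) : CKFamily E E.GraphCStar where
  S e := ⟨E.prodS e, E.prodS_mem e⟩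
  P x := ⟨E.prodP x, E.prodP_mem x⟩
  isStarProjection_P x :=
    ⟨E.graphCStar_ext fun ρ => (ρ.fam.isStarProjection_P x).isIdempotentElem,
      E.graphCStar_ext fun ρ => (ρ.fam.isStarProjection_P x).isSelfAdjoint⟩
  P_orthogonal x y h := E.graphCStar_ext fun ρ => ρ.fam.P_orthogonal x y h
  S_partialIsometry e := E.graphCStar_ext fun ρ => ρ.fam.S_partialIsometry e
  S_orthogonal e f h := E.graphCStar_ext fun ρ => ρ.fam.S_orthogonal e f h
  star_S_mul_S e := E.graphCStar_ext fun ρ => ρ.fam.star_S_mul_S e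
  range_le e := E.graphCStar_ext fun ρ => ρ.fam.range_le e
  P_eq_sum x h := E.graphCStar_ext fun ρ => by
    rw [map_sum]
    exact ρ.fam.P_eq_sum x h

open scoped CStarAlgebra in
/-- The universal property of `C^*(E)`. -/
theorem existsUnique_hom (E : DirectedGraph V Ed) {B : Type (max u v)} [NonUnitalCStarAlgebra B]
    (F : CKFamily E B) :
    ∃! π : E.GraphCStar →⋆ₙₐ[ℂ] B,
      (∀ e, π (E.univ.S e) = F.S e) ∧ ∀ x, π (E.univ.P x) = F.P x := by
  refine ⟨E.graphEval ⟨B, F⟩, ⟨fun _ => rfl, fun _ => rfl⟩, fun π hπ => ?_⟩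
  have key : E.graphSubalgebra ≤ (NonUnitalStarAlgHom.equalizer π (E.graphEval ⟨B, F⟩)).map
      E.graphIncl := by
    refine NonUnitalStarSubalgebra.topologicalClosure_minimal _ ?_ ?_
    · refine NonUnitalStarAlgebra.adjoin_le ?_
      rintro _ (⟨e, rfl⟩ | ⟨x, rfl⟩)
      · exact ⟨E.univ.S e, hπ.1 e, rfl⟩
      · exact ⟨E.univ.P x, hπ.2 x, rfl⟩
    · have hc : IsClosed (E.graphSubalgebra : Set E.CKProd) :=
        NonUnitalStarSubalgebra.isClosed_topologicalClosure _
      have hemb : Topology.IsClosedEmbedding (Subtype.val : E.graphSubalgebra → E.CKProd) :=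
        hc.isClosedEmbedding_subtypeVal
      have heq : IsClosed {a : E.GraphCStar | π a = E.graphEval ⟨B, F⟩ a} :=
        isClosed_eq (map_continuous π) (map_continuous _)
      exact hemb.isClosedMap _ heq
  ext a
  obtain ⟨b, hb, hba⟩ := key a.2
  have hab : b = a := Subtype.ext hba
  exact hab ▸ hb

/-- The path projection `p_α = s_α s_α^*` in `C^*(E)`. -/
def proj (E : DirectedGraph V Ed) (α : E.FinPath) : E.GraphCStar := E.univ.pathP α

/-- The projection `q_W = ∑_{x ∈ W} p_x` in `C^*(E)`. -/
def q (E : DirectedGraph V Ed) (W : Finset V) : E.GraphCStar := E.univ.sumP W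

/-! ### The diagonal -/

/-- The diagonal `𝒟(E)`: the C⋆-subalgebra of `C^*(E)` generated by all `p_α`. -/
def diagonal (E : DirectedGraph V Ed) : NonUnitalStarSubalgebra ℂ E.GraphCStar :=
  (NonUnitalStarAlgebra.adjoin ℂ (Set.range E.proj)).topologicalClosure

theorem proj_mem_diagonal (E : DirectedGraph V Ed) (α : E.FinPath) : E.proj α ∈ E.diagonal :=
  NonUnitalStarSubalgebra.le_topologicalClosure _
    (NonUnitalStarAlgebra.subset_adjoin ℂ _ ⟨α, rfl⟩)

theorem P_mem_diagonal (E : DirectedGraph V Ed) (x : V) : E.univ.P x ∈ E.diagonal := by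
  rw [← CKFamily.pathP_vertexPath]
  exact E.proj_mem_diagonal _

theorem q_mem_diagonal (E : DirectedGraph V Ed) (W : Finset V) : E.q W ∈ E.diagonal :=
  sum_mem fun x _ => E.P_mem_diagonal x

theorem star_q (E : DirectedGraph V Ed) (W : Finset V) : star (E.q W) = E.q W :=
  E.univ.star_sumP W

theorem q_mul_q (E : DirectedGraph V Ed) {W W' : Finset V} (h : W ⊆ W') :
    E.q W * E.q W' = E.q W := E.univ.sumP_mul_sumP h

theorem commute_q (E : DirectedGraph V Ed) (W : Finset V) {d : E.GraphCStar}
    (hd : d ∈ E.diagonal) : E.q W * d = d * E.q W := by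
  have hle : E.diagonal ≤ NonUnitalStarSubalgebra.centralizer ℂ {E.q W} := by
    refine NonUnitalStarSubalgebra.topologicalClosure_minimal _ ?_ (Set.isClosed_centralizer _)
    refine NonUnitalStarAlgebra.adjoin_le ?_
    rintro _ ⟨α, rfl⟩
    have hα : E.q W * E.proj α = E.proj α * E.q W := by
      rw [q, CKFamily.sumP, Finset.sum_mul, Finset.mul_sum]
      exact Finset.sum_congr rfl fun x _ => E.univ.commute_P_pathP x α
    rw [SetLike.mem_coe, NonUnitalStarSubalgebra.mem_centralizer_iff]
    rintro _ rfl
    exact ⟨hα, by rw [E.star_q]; exact hα⟩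
  exact ((NonUnitalStarSubalgebra.mem_centralizer_iff ℂ).1 (hle hd) _ rfl).1

/-- The corner `𝒟(E) q_W`, for a finite set `W` of vertices. -/
def corner (E : DirectedGraph V Ed) (W : Finset V) : NonUnitalStarSubalgebra ℂ E.GraphCStar where
  carrier := {a | ∃ d ∈ E.diagonal, a = d * E.q W}
  zero_mem' := ⟨0, zero_mem _, by rw [zero_mul]⟩
  add_mem' := by
    rintro _ _ ⟨d, hd, rfl⟩ ⟨d', hd', rfl⟩
    exact ⟨d + d', add_mem hd hd', by rw [add_mul]⟩
  mul_mem' := by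
    rintro _ _ ⟨d, hd, rfl⟩ ⟨d', hd', rfl⟩
    exact ⟨d * E.q W * d', mul_mem (mul_mem hd (E.q_mem_diagonal W)) hd', by
      simp only [mul_assoc]⟩
  smul_mem' := by
    rintro c _ ⟨d, hd, rfl⟩
    exact ⟨c • d, SMulMemClass.smul_mem c hd, by rw [smul_mul_assoc]⟩
  star_mem' := by
    rintro _ ⟨d, hd, rfl⟩
    exact ⟨star d, star_mem hd, by rw [star_mul, E.star_q, E.commute_q W (star_mem hd)]⟩

theorem corner_le_diagonal (E : DirectedGraph V Ed) (W : Finset V) : E.corner W ≤ E.diagonal := by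
  rintro _ ⟨d, hd, rfl⟩
  exact mul_mem hd (E.q_mem_diagonal W)

theorem corner_mono (E : DirectedGraph V Ed) {W W' : Finset V} (h : W ⊆ W') :
    E.corner W ≤ E.corner W' := by
  rintro _ ⟨d, hd, rfl⟩
  exact ⟨d * E.q W, mul_mem hd (E.q_mem_diagonal W), by rw [mul_assoc, E.q_mul_q h]⟩

open Classical in
/-- The `⋆`-algebra `𝒟(E)_fin = ⋃_W 𝒟(E) q_W`, over the finite sets `W` of vertices. -/
def diagonalFin (E : DirectedGraph V Ed) : NonUnitalStarSubalgebra ℂ E.GraphCStar where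
  carrier := {a | ∃ W, a ∈ E.corner W}
  zero_mem' := ⟨∅, zero_mem _⟩
  add_mem' := by
    rintro _ _ ⟨W, h⟩ ⟨W', h'⟩
    exact ⟨W ∪ W', add_mem (E.corner_mono Finset.subset_union_left h)
      (E.corner_mono Finset.subset_union_right h')⟩
  mul_mem' := by
    rintro _ _ ⟨W, h⟩ ⟨W', h'⟩
    exact ⟨W ∪ W', mul_mem (E.corner_mono Finset.subset_union_left h)
      (E.corner_mono Finset.subset_union_right h')⟩
  smul_mem' := by
    rintro c _ ⟨W, h⟩
    exact ⟨W, SMulMemClass.smul_mem c h⟩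
  star_mem' := by
    rintro _ ⟨W, h⟩
    exact ⟨W, star_mem h⟩

theorem corner_le_diagonalFin (E : DirectedGraph V Ed) (W : Finset V) :
    E.corner W ≤ E.diagonalFin := fun _ h => ⟨W, h⟩

theorem diagonalFin_le_diagonal (E : DirectedGraph V Ed) : E.diagonalFin ≤ E.diagonal := by
  rintro _ ⟨W, h⟩
  exact E.corner_le_diagonal W h

theorem proj_mem_diagonalFin (E : DirectedGraph V Ed) (α : E.FinPath) :
    E.proj α ∈ E.diagonalFin :=
  ⟨{α.range}, E.proj α, E.proj_mem_diagonal α, by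
    rw [q, CKFamily.sumP, Finset.sum_singleton]
    exact (E.univ.pathP_mul_P α).symm⟩

/-- `p_α` as an element of `𝒟(E)`. -/
def diagProj (E : DirectedGraph V Ed) (α : E.FinPath) : E.diagonal :=
  ⟨E.proj α, E.proj_mem_diagonal α⟩

/-- `p_x` as an element of `𝒟(E)`. -/
def diagP (E : DirectedGraph V Ed) (x : V) : E.diagonal :=
  ⟨E.univ.P x, E.P_mem_diagonal x⟩

/-- `p_α` as an element of `𝒟(E)_fin`. -/
def diagFinProj (E : DirectedGraph V Ed) (α : E.FinPath) : E.diagonalFin :=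
  ⟨E.proj α, E.proj_mem_diagonalFin α⟩

/-! ### Graph traces -/

/-- `‖g‖₁ = ∑_x g(x) ∈ [0, ∞]`. -/
def norm1 (g : V → ℝ≥0) : ℝ≥0∞ := ∑' x, (g x : ℝ≥0∞)

/-- The set `T(E)` of graph traces on `E`; the sums over `r⁻¹(x)` are taken in `[0, ∞]`. -/
def graphTraces (E : DirectedGraph V Ed) : Set (V → ℝ≥0) :=
  {g | (∀ x, ∑' e : {e // E.r e = x}, (g (E.s e) : ℝ≥0∞) ≤ g x) ∧
    ∀ x, E.IsRegular x → ∑' e : {e // E.r e = x}, (g (E.s e) : ℝ≥0∞) = g x}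

/-- The set `T₁(E)` of normalized graph traces. -/
def normalizedGraphTraces (E : DirectedGraph V Ed) : Set (V → ℝ≥0) :=
  {g | g ∈ E.graphTraces ∧ norm1 g = 1}

end DirectedGraph

/-! ### Functionals, states, invariance -/

/-- A linear functional `f` on a `⋆`-algebra is positive if `f (a⋆ a) ≥ 0` for all `a`
(in particular `f (a⋆ a)` is real). -/
def IsPositiveFunctional {M : Type w} [NonUnitalRing M] [StarRing M] [Module ℂ M]
    (f : M →ₗ[ℂ] ℂ) : Prop :=
  ∀ a, 0 ≤ f (star a * a)

/-- The linear functional `f` is bounded, with norm `c`. -/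
def FunctionalHasNorm {M : Type w} [NonUnitalNormedRing M] [NormedSpace ℂ M]
    (f : M →ₗ[ℂ] ℂ) (c : ℝ) : Prop :=
  ∃ F : M →L[ℂ] ℂ, (F : M →ₗ[ℂ] ℂ) = f ∧ ‖F‖ = c

section Inclusion

variable {A : Type w} [NonUnitalCStarAlgebra A]

/-- The restriction of a linear functional to a smaller `⋆`-subalgebra. -/
def restrictFunctional {B C : NonUnitalStarSubalgebra ℂ A} (h : B ≤ C) (f : C →ₗ[ℂ] ℂ) :
    B →ₗ[ℂ] ℂ where
  toFun b := f ⟨b, h b.2⟩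
  map_add' a b := map_add f ⟨a, h a.2⟩ ⟨b, h b.2⟩
  map_smul' c b := map_smul f c ⟨b, h b.2⟩

/-- The states on `B`: the positive linear functionals of norm one. -/
def states (B : NonUnitalStarSubalgebra ℂ A) : Set (B →L[ℂ] ℂ) :=
  {φ | IsPositiveFunctional (φ : B →ₗ[ℂ] ℂ) ∧ ‖φ‖ = 1}

/-- The normalizers of `B` in `A`. -/
def normalizers (B : NonUnitalStarSubalgebra ℂ A) : Set A :=
  {n | ∀ b ∈ B, n * b * star n ∈ B ∧ star n * b * n ∈ B}

/-- The set `S^inv(B)` of fully invariant states on `B`: those that satisfy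
`φ(n b n⋆) = φ(n⋆ n b)` for every normalizer `n` of `B` and every `b ∈ B`. (If `B` is
non-degenerate, i.e. contains an approximate unit of `A`, then `n⋆ n b ∈ B` holds automatically.) -/
def fullyInvariantStates (B : NonUnitalStarSubalgebra ℂ A) : Set (B →L[ℂ] ℂ) :=
  {φ | φ ∈ states B ∧ ∀ n (hn : n ∈ normalizers B) (b : B),
    ∃ h : star n * n * (b : A) ∈ B, φ ⟨n * b * star n, (hn b b.2).1⟩ = φ ⟨star n * n * b, h⟩}

end Inclusion

end

/-! The content is the existence of the functionals: a linear functional on the diagonal cannot be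
defined by prescribing its values on the $p_\lambda$ without proving positivity and boundedness. So
they are built on all of $C^*(E)$, one vertex at a time. A graph trace $g$ should give positive
functionals $\omega_x$ of mass $g(x)$, supported at $p_x$, with $\omega_{r(f)}(s_f
a)=\omega_{s(f)}(a s_f)$ for every edge $f$; then $\omega_{r(\lambda)}(p_\lambda)=g(s(\lambda))$ by
moving $s_\lambda$ to the right.

Such a family is the fixed point of a transfer operation,
$\varphi'_x=c_x\kappa_x+\sum_{r(e)=x}\varphi_{s(e)}(s_e^*\,\cdot\,s_e)$, where $c_x$ is the defect
in the graph trace inequality at $x$ and $\kappa_x$ is a vertex state. One always has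
$\varphi'_{r(f)}(s_fa)=\varphi_{s(f)}(as_f)$, provided the defect term does not interfere: either
$x$ is regular and $c_x=0$, or $\kappa_x$ kills all $s_ea$. Vertex states of the second kind are
vector states of a concrete representation on $\ell^2(V\times\mathbb N)$ (`exists_vertexState`).
Cesàro means of the iterates, taken along an ultrafilter, converge to the fixed point
(`exists_isTracialFamily`).

The functional $\sum_x\omega_x$ is a finite sum on each corner, which gives $\eta_g$; its norms are
attained or approximated at the $q_W$. If $\|g\|_1<\infty$, the sum converges to a bounded trace on
$C^*(E)$ (`IsTracialFamily.exists_trace`), and a trace restricts to a fully invariant functional.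

Uniqueness holds because the $p_\lambda$ span a dense subspace of the diagonal and positive
functionals are automatically bounded on the corners. Conversely, invariance of $\theta$ under the
normalizer $s_\lambda$ forces $\theta(p_\lambda)=\theta(p_{s(\lambda)})$. The projections
$p_x-\sum_{e\in F}p_e$ give the graph trace inequality, and Cauchy–Schwarz against the approximate
unit $q_W$ gives total mass one (`norm1_vertexWeight`). -/

noncomputable section

open Filter Topology

/-! ### Operators on `ℓ²` given by partial bijections -/

namespace PEquiv

variable {I : Type w}

/-- The function `x ∘ f⁻¹`, extended by zero. -/
def pushFun (f : I ≃. I) (x : I → ℂ) (i : I) : ℂ := (f.symm i).elim 0 x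

theorem pushFun_of_mem (f : I ≃. I) (x : I → ℂ) {i j : I} (h : f j = some i) :
    f.pushFun x i = x j := by
  rw [pushFun, (f.eq_some_iff).2 h, Option.elim_some]

theorem pushFun_of_forall_ne (f : I ≃. I) (x : I → ℂ) {i : I} (h : ∀ j, f j ≠ some i) :
    f.pushFun x i = 0 := by
  have : f.symm i = none := by
    rw [Option.eq_none_iff_forall_ne_some]
    exact fun j hj => h j ((f.eq_some_iff).1 hj)
  rw [pushFun, this, Option.elim_none]

/-- On the range of `f` the pushed function is `x` reindexed along the injective map `f.symm`, and
off the range it vanishes; its sum is therefore a subsum of that of `x`. -/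
theorem summable_pushFun (f : I ≃. I) (x : I → ℂ) (hx : Summable fun i => ‖x i‖ ^ (2 : ℝ)) :
    (Summable fun i => ‖f.pushFun x i‖ ^ (2 : ℝ)) ∧
      ∑' i, ‖f.pushFun x i‖ ^ (2 : ℝ) ≤ ∑' i, ‖x i‖ ^ (2 : ℝ) := by
  have hD (i : {i // (f.symm i).isSome}) : f ((f.symm i).get i.2) = some i.1 :=
    (f.eq_some_iff).1 (Option.some_get i.2).symm
  have hinj : Function.Injective fun i : {i // (f.symm i).isSome} => (f.symm i).get i.2 := by
    intro i j hij
    have h := hD i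
    dsimp only at hij
    rw [hij, hD j, Option.some_inj] at h
    exact Subtype.ext h.symm
  have hval : (fun i => ‖f.pushFun x i‖ ^ (2 : ℝ)) ∘ (Subtype.val : {i // (f.symm i).isSome} → I) =
      (fun i => ‖x i‖ ^ (2 : ℝ)) ∘ fun i : {i // (f.symm i).isSome} => (f.symm i).get i.2 := by
    ext i
    simp only [Function.comp_apply]
    rw [f.pushFun_of_mem x (hD i)]
  have hzero : ∀ i ∉ Set.range (Subtype.val : {i // (f.symm i).isSome} → I),
      ‖f.pushFun x i‖ ^ (2 : ℝ) = 0 := by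
    intro i hi
    replace hi : ¬ (f.symm i).isSome := fun h => hi ⟨⟨i, h⟩, rfl⟩
    rw [Option.not_isSome_iff_eq_none] at hi
    simp [pushFun, hi]
  refine ⟨(Subtype.val_injective.summable_iff hzero).1 ?_, ?_⟩
  · rw [hval]
    exact hx.comp_injective hinj
  · rw [← Subtype.val_injective.tsum_eq (Function.support_subset_iff'.2 hzero)]
    exact (congrArg tsum hval).trans_le
      (tsum_comp_le_tsum_of_inj hx (fun _ => by positivity) hinj)

/-- The partial isometry of `ℓ²(I)` given by a partial bijection of `I`. -/
def toL2 (f : I ≃. I) : lp (fun _ : I => ℂ) 2 →L[ℂ] lp (fun _ : I => ℂ) 2 :=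
  have hs (x : lp (fun _ : I => ℂ) 2) : Summable fun i => ‖x i‖ ^ (2 : ℝ) := by
    simpa using (lp.memℓp x).summable (by norm_num)
  LinearMap.mkContinuous
    { toFun x := ⟨f.pushFun x, memℓp_gen (by simpa using (f.summable_pushFun x (hs x)).1)⟩
      map_add' x y := by
        ext i
        change ((f.symm i).elim 0 fun j => x j + y j) = (f.symm i).elim 0 x + (f.symm i).elim 0 y
        cases f.symm i <;> simp
      map_smul' c x := by
        ext i
        change ((f.symm i).elim 0 fun j => c * x j) = c * (f.symm i).elim 0 x
        cases f.symm i <;> simp } 1 fun x => by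
    have h := (f.summable_pushFun x (hs x)).2
    rw [one_mul]
    have h2 := fun y : lp (fun _ : I => ℂ) 2 =>
      lp.norm_rpow_eq_tsum (p := 2) (by norm_num) y
    simp only [ENNReal.toReal_ofNat] at h2
    refine (Real.rpow_le_rpow_iff (norm_nonneg _) (norm_nonneg _) (z := 2) (by norm_num)).1 ?_
    rw [h2, h2]
    exact h

theorem toL2_apply (f : I ≃. I) (x : lp (fun _ : I => ℂ) 2) (i : I) :
    f.toL2 x i = f.pushFun x i := rfl

theorem toL2_mul (f g : I ≃. I) : f.toL2 * g.toL2 = (g.trans f).toL2 := by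
  ext x i
  change f.pushFun (g.pushFun x) i = (g.trans f).pushFun x i
  rw [pushFun, pushFun, symm_trans_rev]
  cases h : f.symm i with
  | none => simp [PEquiv.trans, h]
  | some j => simp [PEquiv.trans, h, pushFun]

/-- Both inner products are sums over the pairs `f i = some j` of the same terms, indexed once by
`j` and once by `i`, so it is enough to match the supports. -/
theorem star_toL2 (f : I ≃. I) : star f.toL2 = f.symm.toL2 := by
  rw [ContinuousLinearMap.star_eq_adjoint, eq_comm, ContinuousLinearMap.eq_adjoint_iff]
  intro x y
  rw [lp.inner_eq_tsum, lp.inner_eq_tsum]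
  simp only [toL2_apply]
  have hne (j : Function.support fun j => inner ℂ (x j) (f.pushFun y j)) :
      ∃ i, f i = some j.1 := by
    by_contra! h
    exact j.2 (by simp only [f.pushFun_of_forall_ne _ h, inner_zero_right])
  choose i hi using hne
  refine tsum_eq_tsum_of_ne_zero_bij i ?_ ?_ ?_
  · intro j k hjk
    have := hi j
    rw [hjk, hi k, Option.some_inj] at this
    exact Subtype.ext this.symm
  · intro k hk
    by_cases h : ∃ j, f k = some j
    · obtain ⟨j, hj⟩ := h
      have hj' : f.symm j = some k := (f.eq_some_iff).2 hj
      have hk' : inner ℂ (x j) (f.pushFun y j) ≠ 0 := by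
        rw [f.pushFun_of_mem _ hj]
        rwa [Function.mem_support, f.symm.pushFun_of_mem _ hj'] at hk
      refine ⟨⟨j, hk'⟩, ?_⟩
      have h2 := (f.eq_some_iff).2 (hi ⟨j, hk'⟩)
      rw [hj', Option.some_inj] at h2
      exact h2.symm
    · push Not at h
      refine absurd ?_ hk
      simp only [f.symm.pushFun_of_forall_ne x fun j hj => h j ((f.eq_some_iff).1 hj),
        inner_zero_left]
  · intro j
    rw [f.symm.pushFun_of_mem _ ((f.eq_some_iff).2 (hi j)), f.pushFun_of_mem _ (hi j)]

end PEquiv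

open Classical in
/-- The projection of `ℓ²(I)` onto the functions supported on `s`. -/
def restrictL2 {I : Type w} (s : Set I) : lp (fun _ : I => ℂ) 2 →L[ℂ] lp (fun _ : I => ℂ) 2 :=
  (PEquiv.ofSet s).toL2

section RestrictL2

variable {I : Type w}

theorem restrictL2_apply_of_mem {s : Set I} (x : lp (fun _ : I => ℂ) 2) {i : I} (h : i ∈ s) :
    restrictL2 s x i = x i :=
  PEquiv.pushFun_of_mem _ _ (by simpa using h)

theorem restrictL2_apply_of_notMem {s : Set I} (x : lp (fun _ : I => ℂ) 2) {i : I} (h : i ∉ s) :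
    restrictL2 s x i = 0 := by
  refine PEquiv.pushFun_of_forall_ne _ _ fun j hj => h ?_
  rw [PEquiv.ofSet_eq_some_iff] at hj
  exact hj.1 ▸ hj.2

theorem restrictL2_mul (s t : Set I) : restrictL2 s * restrictL2 t = restrictL2 (s ∩ t) := by
  ext x i
  change restrictL2 s (restrictL2 t x) i = _
  by_cases hs : i ∈ s
  · rw [restrictL2_apply_of_mem _ hs]
    by_cases ht : i ∈ t
    · rw [restrictL2_apply_of_mem _ ht, restrictL2_apply_of_mem _ (Set.mem_inter hs ht)]
    · rw [restrictL2_apply_of_notMem _ ht, restrictL2_apply_of_notMem _ fun h => ht h.2]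
  · rw [restrictL2_apply_of_notMem _ hs, restrictL2_apply_of_notMem _ fun h => hs h.1]

theorem restrictL2_empty : restrictL2 (∅ : Set I) = 0 := by
  ext x i
  exact restrictL2_apply_of_notMem _ (Set.notMem_empty i)

theorem star_restrictL2 (s : Set I) : star (restrictL2 s) = restrictL2 s := by
  rw [restrictL2, PEquiv.star_toL2, PEquiv.ofSet_symm]

theorem PEquiv.toL2_mul_star (f : I ≃. I) :
    f.toL2 * star f.toL2 = restrictL2 {i | ∃ j, f j = some i} := by
  rw [star_toL2, toL2_mul, symm_trans_self, restrictL2]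
  congr! with i
  simp only [Option.isSome_iff_exists, f.eq_some_iff]

theorem PEquiv.star_toL2_mul (f : I ≃. I) :
    star f.toL2 * f.toL2 = restrictL2 {i | ∃ j, f i = some j} := by
  rw [star_toL2, toL2_mul, self_trans_symm, restrictL2]
  congr! with i
  simp only [Option.isSome_iff_exists]

end RestrictL2

/-! ### A Cuntz–Krieger family with non-zero vertex projections -/

namespace DirectedGraph

variable {V : Type u} {Ed : Type v}

/-- Labels `code e k` for the pairs of an edge and a natural number, such that for each vertex `x`
the labels are distinct over `r⁻¹(x)`, exhaust `ℕ` if `x` is regular and avoid `0` otherwise. -/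
theorem exists_edge_code [Countable Ed] (E : DirectedGraph V Ed) : ∃ code : Ed → ℕ → ℕ,
    (∀ e f k l, E.r e = E.r f → code e k = code f l → e = f ∧ k = l) ∧
    (∀ x, E.IsRegular x → ∀ n, ∃ e k, E.r e = x ∧ code e k = n) ∧
    ∀ e k, ¬ E.IsRegular (E.r e) → code e k ≠ 0 := by
  have h (x : V) : ∃ φ : {e // E.r e = x} × ℕ → ℕ, Function.Injective φ ∧
      (E.IsRegular x → Function.Surjective φ) ∧ (¬ E.IsRegular x → ∀ p, φ p ≠ 0) := by
    by_cases hx : E.IsRegular x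
    · have : Nonempty {e // E.r e = x} := hx.2.to_subtype
      -- The factor `ℕ` makes even a finite non-empty fibre denumerable, so that a bijection with
      -- `ℕ` exists.
      obtain ⟨_⟩ := nonempty_denumerable ({e // E.r e = x} × ℕ)
      exact ⟨Denumerable.eqv _, (Denumerable.eqv _).injective, fun _ => (Denumerable.eqv _).surjective,
        fun h => absurd hx h⟩
    · obtain ⟨φ, hφ⟩ := exists_injective_nat ({e // E.r e = x} × ℕ)
      -- The shift by one keeps the label `0` free at a vertex that is not regular.
      exact ⟨fun p => φ p + 1, fun p q hpq => hφ (Nat.succ_injective hpq), fun h => absurd h hx,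
        fun _ p => Nat.succ_ne_zero _⟩
  choose φ hφ using h
  refine ⟨fun e k => φ (E.r e) (⟨e, rfl⟩, k), ?_, ?_, ?_⟩
  · intro e f k l hef h
    -- The labels of `e` and `f` use `φ` at two vertices that are only propositionally equal; both
    -- are transported to a common `x`.
    have key : ∀ x (he : E.r e = x) (hf : E.r f = x), φ x (⟨e, he⟩, k) = φ x (⟨f, hf⟩, l) →
        e = f ∧ k = l := by
      intro x he hf h
      simpa using (hφ x).1 h
    refine key (E.r f) hef rfl ?_
    refine Eq.trans ?_ h
    have key' : ∀ x (he : E.r e = x), φ x (⟨e, he⟩, k) = φ (E.r e) (⟨e, rfl⟩, k) := by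
      rintro x rfl
      rfl
    exact key' _ hef
  · intro x hx n
    obtain ⟨⟨⟨e, rfl⟩, k⟩, hk⟩ := (hφ x).2.1 hx n
    exact ⟨e, k, rfl, hk⟩
  · exact fun e k h => (hφ _).2.2 h _

open Classical in
/-- The partial bijection `(s(e), k) ↦ (r(e), code e k)`. -/
def edgePEquiv (E : DirectedGraph V Ed) (code : Ed → ℕ → ℕ)
    (hc : ∀ e f k l, E.r e = E.r f → code e k = code f l → e = f ∧ k = l) (e : Ed) :
    (ULift.{v} V × ℕ) ≃. (ULift.{v} V × ℕ) where
  toFun i := if i.1.down = E.s e then some (⟨E.r e⟩, code e i.2) else none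
  invFun j := if h : ∃ k, j = (⟨E.r e⟩, code e k) then some (⟨E.s e⟩, h.choose) else none
  inv := by
    rintro ⟨⟨x⟩, k⟩ j
    constructor
    · intro h
      split_ifs at h with h1
      have h2 := h1.choose_spec
      simp only [Option.some_inj, Prod.mk.injEq, ULift.up.injEq] at h
      rw [if_pos h.1.symm, ← h.2, ← h2]
    · intro h
      split_ifs at h with h1
      rw [Option.some_inj] at h
      have h2 : ∃ k, j = (⟨E.r e⟩, code e k) := ⟨k, h.symm⟩
      rw [dif_pos h2]
      have h3 := h.trans h2.choose_spec
      rw [Prod.mk.injEq] at h3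
      rw [← (hc e e _ _ rfl h3.2).2, ← h1]

open Classical in
theorem edgePEquiv_eq_some_iff (E : DirectedGraph V Ed) (code : Ed → ℕ → ℕ)
    (hc : ∀ e f k l, E.r e = E.r f → code e k = code f l → e = f ∧ k = l) (e : Ed)
    (i j : ULift.{v} V × ℕ) : E.edgePEquiv code hc e i = some j ↔
      i.1.down = E.s e ∧ j = (⟨E.r e⟩, code e i.2) := by
  change (if i.1.down = E.s e then some (⟨E.r e⟩, code e i.2) else none) = some j ↔ _
  split_ifs with h
  · simp only [h, true_and, Option.some_inj, eq_comm]
  · simp [h]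

/-- The Cuntz–Krieger family on `ℓ²(V × ℕ)` given by a labelling of the edges. -/
def codeFamily (E : DirectedGraph V Ed) (code : Ed → ℕ → ℕ)
    (hc : ∀ e f k l, E.r e = E.r f → code e k = code f l → e = f ∧ k = l)
    (hr : ∀ x, E.IsRegular x → ∀ n, ∃ e k, E.r e = x ∧ code e k = n) :
    CKFamily E (lp (fun _ : ULift.{v} V × ℕ => ℂ) 2 →L[ℂ] lp (fun _ : ULift.{v} V × ℕ => ℂ) 2) where
  S e := (E.edgePEquiv code hc e).toL2
  P x := restrictL2 {i : ULift.{v} V × ℕ | i.1.down = x}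
  isStarProjection_P x := by
    refine ⟨?_, star_restrictL2 _⟩
    rw [IsIdempotentElem, restrictL2_mul, Set.inter_self]
  P_orthogonal x y hxy := by
    rw [restrictL2_mul, ← restrictL2_empty]
    congr 1
    exact Set.eq_empty_iff_forall_notMem.2 fun i hi => hxy (hi.1.symm.trans hi.2)
  S_partialIsometry e := by
    rw [PEquiv.toL2_mul_star]
    ext z i
    change restrictL2 _ ((E.edgePEquiv code hc e).toL2 z) i = _
    by_cases h : i ∈ {i | ∃ j, E.edgePEquiv code hc e j = some i}
    · exact restrictL2_apply_of_mem _ h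
    · refine (restrictL2_apply_of_notMem _ h).trans ?_
      exact (PEquiv.pushFun_of_forall_ne _ _ fun j hj => h ⟨j, hj⟩).symm
  S_orthogonal e f hef := by
    rw [PEquiv.toL2_mul_star, PEquiv.toL2_mul_star, restrictL2_mul, ← restrictL2_empty]
    congr 1
    refine Set.eq_empty_iff_forall_notMem.2 ?_
    rintro i ⟨⟨j, hj⟩, ⟨k, hk⟩⟩
    rw [edgePEquiv_eq_some_iff] at hj hk
    have h := hj.2.symm.trans hk.2
    simp only [Prod.mk.injEq, ULift.up.injEq] at h
    exact hef (hc e f _ _ h.1 h.2).1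
  star_S_mul_S e := by
    rw [PEquiv.star_toL2_mul]
    congr! 2 with i
    simp only [edgePEquiv_eq_some_iff, exists_and_left, exists_eq, and_true]
  range_le e := by
    rw [PEquiv.toL2_mul_star, restrictL2_mul]
    congr 1
    refine Set.inter_eq_right.2 ?_
    rintro i ⟨j, hj⟩
    rw [edgePEquiv_eq_some_iff] at hj
    rw [hj.2]
    rfl
  P_eq_sum x hx := by
    ext z i
    rw [sum_apply, lp.coeFn_sum, Finset.sum_apply]
    simp only [PEquiv.toL2_mul_star]
    by_cases h : i ∈ {i : ULift.{v} V × ℕ | i.1.down = x}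
    -- Surjectivity of the labels over a regular vertex puts each index `(x, n)` in the range of
    -- some edge, and injectivity makes that edge unique, so one term of the sum survives.
    · rw [restrictL2_apply_of_mem _ h]
      obtain ⟨e, k, he, hk⟩ := hr x hx i.2
      have hi : E.edgePEquiv code hc e (⟨E.s e⟩, k) = some i := by
        rw [edgePEquiv_eq_some_iff]
        refine ⟨rfl, ?_⟩
        rw [he, hk, ← show i.1.down = x from h]
      rw [Finset.sum_eq_single e]
      · exact (restrictL2_apply_of_mem _ (Set.mem_ofPred.2 ⟨_, hi⟩)).symm
      · intro f _ hfe
        refine restrictL2_apply_of_notMem _ ?_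
        rintro ⟨j, hj⟩
        rw [edgePEquiv_eq_some_iff] at hj hi
        have h := hj.2.symm.trans hi.2
        simp only [Prod.mk.injEq, ULift.up.injEq] at h
        exact hfe (hc f e _ _ h.1 h.2).1
      · intro h
        simp [he] at h
    · rw [restrictL2_apply_of_notMem _ h]
      symm
      refine Finset.sum_eq_zero fun e he => restrictL2_apply_of_notMem _ ?_
      rintro ⟨j, hj⟩
      rw [edgePEquiv_eq_some_iff] at hj
      rw [Set.Finite.mem_toFinset] at he
      exact h (by rw [hj.2]; exact he)

/-! ### Positive functionals of mass `t` supported at a vertex -/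

/-- A positive hermitian functional on `C^*(E)` of norm at most `t` that is supported on `p_x`
and takes the value `t` there. -/
structure IsVertexFunctional (E : DirectedGraph V Ed) (x : V) (t : ℝ)
    (φ : E.GraphCStar →L[ℂ] ℂ) : Prop where
  pos : ∀ a, 0 ≤ φ (star a * a)
  map_star : ∀ a, φ (star a) = star (φ a)
  bound : ∀ a, ‖φ a‖ ≤ t * ‖a‖
  map_P : φ (E.univ.P x) = t
  map_P_mul : ∀ a, φ (E.univ.P x * a) = φ a

/-- Each vertex `x` has a vertex state, which can be taken to vanish on all `s_e s_e^*` if `x` is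
not regular. -/
theorem exists_vertexState [Countable Ed] (E : DirectedGraph V Ed) (x : V) :
    ∃ φ : E.GraphCStar →L[ℂ] ℂ, E.IsVertexFunctional x 1 φ ∧
      (¬ E.IsRegular x → ∀ e a, φ (E.univ.S e * a) = 0) := by
  classical
  obtain ⟨code, hc, hr, h0⟩ := E.exists_edge_code
  -- The `ULift` in the index set places the operator algebra in the universe required by the
  -- universal property.
  obtain ⟨π, ⟨hS, hP⟩, -⟩ := E.existsUnique_hom (E.codeFamily code hc hr)
  set ξ : lp (fun _ : ULift.{v} V × ℕ => ℂ) 2 := lp.single 2 (⟨x⟩, 0) 1 with hξ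
  have hval (y : lp (fun _ : ULift.{v} V × ℕ => ℂ) 2) : inner ℂ ξ y = y (⟨x⟩, 0) := by
    rw [hξ, lp.inner_single_left]
    simp
  have hnorm : ‖ξ‖ = 1 := by
    rw [hξ, lp.norm_single (by norm_num), norm_one]
  have hπ (a : E.GraphCStar) : ‖π a‖ ≤ ‖a‖ := NonUnitalStarAlgHom.norm_apply_le π a
  let φ : E.GraphCStar →L[ℂ] ℂ := LinearMap.mkContinuous
    { toFun a := inner ℂ ξ (π a ξ)
      map_add' a b := by rw [map_add, add_apply, inner_add_right]
      map_smul' c a := by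
        rw [map_smul, smul_apply, inner_smul_right]; rfl } 1 fun a => by
    change ‖inner ℂ ξ (π a ξ)‖ ≤ _
    refine (norm_inner_le_norm _ _).trans ?_
    rw [hnorm, one_mul, one_mul]
    refine ((π a).le_opNorm ξ).trans ?_
    rw [hnorm, mul_one]
    exact hπ a
  have hφ (a) : φ a = inner ℂ ξ (π a ξ) := rfl
  have hPξ (y : lp (fun _ : ULift.{v} V × ℕ => ℂ) 2) :
      π (E.univ.P x) y (⟨x⟩, 0) = y (⟨x⟩, 0) := by
    rw [hP]
    exact restrictL2_apply_of_mem _ rfl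
  refine ⟨φ, ⟨?_, ?_, ?_, ?_, ?_⟩, ?_⟩
  · intro a
    rw [hφ, map_mul, StarHomClass.map_star, mul_apply_eq_comp,
      ContinuousLinearMap.star_eq_adjoint, ContinuousLinearMap.adjoint_inner_right,
      inner_self_eq_norm_sq_to_K]
    rw [← RCLike.ofReal_pow]
    exact RCLike.ofReal_nonneg.2 (sq_nonneg _)
  · intro a
    rw [hφ, hφ, StarHomClass.map_star, ContinuousLinearMap.star_eq_adjoint,
      ContinuousLinearMap.adjoint_inner_right, ← inner_conj_symm]
    rfl
  · intro a
    exact LinearMap.mkContinuous_norm_le _ zero_le_one _ |> φ.le_of_opNorm_le <| a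
  · rw [hφ, hval, hPξ, hξ, lp.single_apply_self, Complex.ofReal_one]
  · intro a
    rw [hφ, hφ, hval, hval, map_mul, mul_apply_eq_comp, hPξ]
  · intro hx e a
    rw [hφ, hval, map_mul, hS, mul_apply_eq_comp]
    -- The basis index `(x, 0)` is outside the range of every edge, because over a non-regular
    -- vertex no label is `0`.
    refine PEquiv.pushFun_of_forall_ne _ _ fun j hj => ?_
    rw [edgePEquiv_eq_some_iff] at hj
    have h := hj.2
    simp only [Prod.mk.injEq, ULift.up.injEq] at h
    exact h0 e j.2 (h.1 ▸ hx) h.2.symm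

end DirectedGraph

/-! ### Path projections and their products in a Cuntz–Krieger family -/

namespace DirectedGraph

variable {V : Type u} {Ed : Type v}

namespace CKFamily

variable {E : DirectedGraph V Ed} {B : Type w} [NonUnitalCStarAlgebra B]

theorem star_P (F : CKFamily E B) (x : V) : star (F.P x) = F.P x :=
  (F.isStarProjection_P x).isSelfAdjoint.star_eq

theorem P_mul_self (F : CKFamily E B) (x : V) : F.P x * F.P x = F.P x :=
  (F.isStarProjection_P x).isIdempotentElem.eq

/-- Each isometry absorbs its own range projection, and the two range projections are orthogonal. -/
theorem star_S_mul_S_of_ne (F : CKFamily E B) {e f : Ed} (h : e ≠ f) :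
    star (F.S e) * F.S f = 0 := by
  have h1 : star (F.S e) = star (F.S e) * (F.S e * star (F.S e)) := by
    conv_lhs => rw [← F.S_partialIsometry e]
    simp only [star_mul, star_star]
  have h2 : F.S f = F.S f * star (F.S f) * F.S f := (F.S_partialIsometry f).symm
  rw [h1, h2, mul_assoc, ← mul_assoc (F.S e * star (F.S e)), F.S_orthogonal e f h, zero_mul,
    mul_zero]

theorem P_mul_star_S (F : CKFamily E B) (e : Ed) :
    F.P (E.s e) * star (F.S e) = star (F.S e) := by
  simpa [F.star_P] using congrArg star (F.S_mul_P e)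

theorem star_S_mul_P (F : CKFamily E B) (e : Ed) :
    star (F.S e) * F.P (E.r e) = star (F.S e) := by
  simpa [F.star_P] using congrArg star (F.P_mul_S e)

theorem star_pathS_mul_pathS (F : CKFamily E B) (α : E.FinPath) :
    star (F.pathS α) * F.pathS α = F.P α.source := by
  obtain ⟨x, l, h⟩ := α
  change star (F.listS x l) * F.listS x l = F.P (E.listSource x l)
  induction l generalizing x with
  | nil => exact (F.star_P x).symm ▸ F.P_mul_self x
  | cons e l ih =>
    change star (F.S e * F.listS (E.s e) l) * (F.S e * F.listS (E.s e) l) = F.P (E.listSource _ l)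
    rw [star_mul, mul_assoc, ← mul_assoc (star (F.S e)), F.star_S_mul_S,
      show F.P (E.s e) * F.listS (E.s e) l = F.listS (E.s e) l from
        F.P_mul_pathS ⟨E.s e, l, h.2⟩, ih _ h.2]

theorem pathS_mul_P (F : CKFamily E B) (α : E.FinPath) :
    F.pathS α * F.P α.source = F.pathS α := by
  obtain ⟨x, l, h⟩ := α
  change F.listS x l * F.P (E.listSource x l) = F.listS x l
  induction l generalizing x with
  | nil => exact F.P_mul_self x
  | cons e l ih =>
    change F.S e * F.listS (E.s e) l * F.P (E.listSource _ l) = F.S e * F.listS (E.s e) l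
    rw [mul_assoc, ih _ h.2]

theorem star_pathP (F : CKFamily E B) (α : E.FinPath) : star (F.pathP α) = F.pathP α := by
  rw [pathP, star_mul, star_star]

theorem P_mul_pathP_of_ne (F : CKFamily E B) {x : V} {α : E.FinPath} (h : x ≠ α.range) :
    F.P x * F.pathP α = 0 := by
  rw [← F.P_mul_pathP, ← mul_assoc, F.P_orthogonal _ _ h, zero_mul]

theorem pathP_cons (F : CKFamily E B) {e : Ed} {l : List Ed}
    (h : E.IsPathFrom (E.r e) (e :: l)) :
    F.pathP ⟨E.r e, e :: l, h⟩ = F.S e * F.pathP ⟨E.s e, l, h.2⟩ * star (F.S e) := by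
  change F.S e * F.listS (E.s e) l * star (F.S e * F.listS (E.s e) l) =
    F.S e * (F.listS (E.s e) l * star (F.listS (E.s e) l)) * star (F.S e)
  simp only [star_mul, mul_assoc]

/-- The product of two path projections is zero or one of the two. -/
theorem pathP_mul_pathP (F : CKFamily E B) (α β : E.FinPath) :
    F.pathP α * F.pathP β = 0 ∨ F.pathP α * F.pathP β = F.pathP α ∨
      F.pathP α * F.pathP β = F.pathP β := by
  obtain ⟨x, l, h⟩ := α
  obtain ⟨y, m, k⟩ := β
  induction l generalizing x y m with
  | nil =>
    rw [show F.pathP ⟨x, [], h⟩ = F.P x from F.pathP_vertexPath x]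
    by_cases hxy : x = y
    · subst hxy
      exact Or.inr (Or.inr (F.P_mul_pathP ⟨x, m, k⟩))
    · exact Or.inl (F.P_mul_pathP_of_ne hxy)
  | cons e l ih =>
    obtain ⟨rfl, h'⟩ := id h
    by_cases hy : y = E.r e
    · subst hy
      cases m with
      | nil =>
        rw [show F.pathP ⟨E.r e, [], k⟩ = F.P (E.r e) from F.pathP_vertexPath _]
        exact Or.inr (Or.inl (F.pathP_mul_P ⟨E.r e, e :: l, h⟩))
      | cons f m =>
        obtain ⟨hf, k'⟩ := id k
        by_cases hef : e = f
        · subst hef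
          have key : F.pathP ⟨E.r e, e :: l, h⟩ * F.pathP ⟨E.r e, e :: m, k⟩ =
              F.S e * (F.pathP ⟨E.s e, l, h'⟩ * F.pathP ⟨E.s e, m, k'⟩) * star (F.S e) := by
            rw [F.pathP_cons h, F.pathP_cons k]
            simp only [mul_assoc]
            rw [← mul_assoc (star (F.S e)) (F.S e), F.star_S_mul_S,
              ← mul_assoc (F.P (E.s e)), F.P_mul_pathP ⟨E.s e, m, k'⟩]
          rw [key, F.pathP_cons h, F.pathP_cons k]
          rcases ih (E.s e) h' (E.s e) m k' with h1 | h1 | h1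
          · exact Or.inl (by rw [h1, mul_zero, zero_mul])
          · exact Or.inr (Or.inl (by rw [h1]))
          · exact Or.inr (Or.inr (by rw [h1]))
        · left
          change F.S e * _ * star (F.S e * _) * (F.S f * _ * star _) = 0
          simp only [star_mul, mul_assoc]
          rw [← mul_assoc (star (F.S e)) (F.S f), F.star_S_mul_S_of_ne hef]
          simp only [mul_zero, zero_mul]
    · left
      rw [← F.pathP_mul_P, mul_assoc]
      change _ * (F.P (E.r e) * _) = _
      rw [F.P_mul_pathP_of_ne (x := E.r e) (α := ⟨y, m, k⟩) (Ne.symm hy), mul_zero]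

/-- Conjugation prepends the edge `e` to the path if they are composable. Together with the reverse
operation below, this makes `S e` a normalizer of the diagonal. -/
theorem S_mul_pathP_mul_star_S (F : CKFamily E B) (e : Ed) (α : E.FinPath) :
    F.S e * F.pathP α * star (F.S e) = 0 ∨
      ∃ β, F.S e * F.pathP α * star (F.S e) = F.pathP β := by
  by_cases h : E.s e = α.range
  · obtain ⟨x, l, hl⟩ := α
    obtain rfl : E.s e = x := h
    exact Or.inr ⟨⟨E.r e, e :: l, rfl, hl⟩, (F.pathP_cons _).symm⟩
  · left
    rw [← F.S_mul_P, mul_assoc (F.S e), F.P_mul_pathP_of_ne h, mul_zero, zero_mul]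

/-- Conjugation by the adjoint removes a first edge `e`, sends the vertex projection at `r e` to the
one at `s e`, and kills every other path projection. -/
theorem star_S_mul_pathP_mul_S (F : CKFamily E B) (e : Ed) (α : E.FinPath) :
    star (F.S e) * F.pathP α * F.S e = 0 ∨
      ∃ β, star (F.S e) * F.pathP α * F.S e = F.pathP β := by
  obtain ⟨x, l, h⟩ := α
  by_cases hx : x = E.r e
  · subst hx
    cases l with
    | nil =>
      refine Or.inr ⟨E.vertexPath (E.s e), ?_⟩
      rw [show F.pathP ⟨E.r e, [], h⟩ = F.P (E.r e) from F.pathP_vertexPath _,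
        F.star_S_mul_P, F.star_S_mul_S, F.pathP_vertexPath]
    | cons f l =>
      obtain ⟨hf, h'⟩ := id h
      by_cases hef : e = f
      · subst hef
        refine Or.inr ⟨⟨E.s e, l, h'⟩, ?_⟩
        rw [F.pathP_cons h]
        simp only [mul_assoc, F.star_S_mul_S]
        simp only [← mul_assoc, F.star_S_mul_S]
        rw [F.P_mul_pathP ⟨E.s e, l, h'⟩]
        exact F.pathP_mul_P ⟨E.s e, l, h'⟩
      · left
        change star (F.S e) * (F.S f * _ * star _) * F.S e = 0
        simp only [← mul_assoc]
        rw [F.star_S_mul_S_of_ne hef]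
        simp only [zero_mul]
  · left
    rw [← F.star_S_mul_P, mul_assoc _ (F.P _), F.P_mul_pathP_of_ne (Ne.symm hx), mul_zero, zero_mul]

end CKFamily

/-! ### Induction principles -/

/-- The image of `M` in the product of all families is a closed ⋆-subalgebra, since $C^*(E)$ is
closed there, and it contains the generators of `graphSubalgebra`. -/
theorem graphCStar_mem_of_generators (E : DirectedGraph V Ed)
    (M : NonUnitalStarSubalgebra ℂ E.GraphCStar) (hM : IsClosed (M : Set E.GraphCStar))
    (hS : ∀ e, E.univ.S e ∈ M) (hP : ∀ x, E.univ.P x ∈ M) (a : E.GraphCStar) : a ∈ M := by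
  have key : E.graphSubalgebra ≤ M.map E.graphIncl := by
    refine NonUnitalStarSubalgebra.topologicalClosure_minimal _ ?_ ?_
    · refine NonUnitalStarAlgebra.adjoin_le ?_
      rintro _ (⟨e, rfl⟩ | ⟨x, rfl⟩)
      · exact ⟨E.univ.S e, hS e, rfl⟩
      · exact ⟨E.univ.P x, hP x, rfl⟩
    · have hc : IsClosed (E.graphSubalgebra : Set E.CKProd) :=
        NonUnitalStarSubalgebra.isClosed_topologicalClosure _
      have hemb : Topology.IsClosedEmbedding (Subtype.val : E.graphSubalgebra → E.CKProd) :=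
        hc.isClosedEmbedding_subtypeVal
      exact hemb.isClosedMap _ hM
  obtain ⟨b, hb, hba⟩ := key a.2
  have hab : b = a := Subtype.ext hba
  exact hab ▸ hb

theorem isClosed_diagonal (E : DirectedGraph V Ed) :
    IsClosed (E.diagonal : Set E.GraphCStar) :=
  NonUnitalStarSubalgebra.isClosed_topologicalClosure _

/-- The path projections are self-adjoint, and a product of two is zero or one of them, so their
linear span is already a ⋆-algebra. -/
theorem diagonal_subset_closure_span (E : DirectedGraph V Ed) :
    (E.diagonal : Set E.GraphCStar) ⊆ closure (Submodule.span ℂ (Set.range E.proj)) := by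
  refine closure_mono fun a ha => ?_
  refine NonUnitalStarAlgebra.adjoin_induction (R := ℂ) (s := Set.range E.proj)
    (p := fun a _ => a ∈ Submodule.span ℂ (Set.range E.proj))
    (fun a h => Submodule.subset_span h) (fun _ _ _ _ => add_mem) (zero_mem _) ?_
    (fun c _ _ => Submodule.smul_mem _ c) ?_ ha
  · intro a b h1 h2 ha hb
    clear h1 h2
    induction ha using Submodule.span_induction with
    | zero => rw [zero_mul]; exact zero_mem _
    | add x y _ _ hx hy => rw [add_mul]; exact add_mem hx hy
    | smul c x _ hx => rw [smul_mul_assoc]; exact Submodule.smul_mem _ c hx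
    | mem x hx =>
      obtain ⟨α, rfl⟩ := hx
      induction hb using Submodule.span_induction with
      | zero => rw [mul_zero]; exact zero_mem _
      | add x y _ _ hx hy => rw [mul_add]; exact add_mem hx hy
      | smul c x _ hx => rw [mul_smul_comm]; exact Submodule.smul_mem _ c hx
      | mem x hx =>
        obtain ⟨β, rfl⟩ := hx
        rcases E.univ.pathP_mul_pathP α β with h | h | h
        · exact h ▸ zero_mem _
        · exact h ▸ Submodule.subset_span ⟨α, rfl⟩
        · exact h ▸ Submodule.subset_span ⟨β, rfl⟩
  · intro a h ha
    clear h
    induction ha using Submodule.span_induction with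
    | zero => rw [star_zero]; exact zero_mem _
    | add x y _ _ hx hy => rw [star_add]; exact add_mem hx hy
    | smul c x _ hx => rw [star_smul]; exact Submodule.smul_mem _ _ hx
    | mem x hx =>
      obtain ⟨α, rfl⟩ := hx
      exact (E.univ.star_pathP α).symm ▸ Submodule.subset_span ⟨α, rfl⟩

theorem diagonal_induction (E : DirectedGraph V Ed) (N : Submodule ℂ E.GraphCStar)
    (hN : IsClosed (N : Set E.GraphCStar)) (h : ∀ α, E.proj α ∈ N) {d : E.GraphCStar}
    (hd : d ∈ E.diagonal) : d ∈ N :=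
  closure_minimal (Submodule.span_le.2 (by rintro _ ⟨α, rfl⟩; exact h α)) hN
    (E.diagonal_subset_closure_span hd)

/-! ### Normalizers -/

theorem mul_mem_normalizers {A : Type w} [NonUnitalCStarAlgebra A]
    {B : NonUnitalStarSubalgebra ℂ A} {m n : A} (hm : m ∈ normalizers B)
    (hn : n ∈ normalizers B) : m * n ∈ normalizers B := by
  intro b hb
  refine ⟨?_, ?_⟩
  · have := (hm _ (hn b hb).1).1
    simpa only [star_mul, mul_assoc] using this
  · have := (hn _ (hm b hb).2).2
    simpa only [star_mul, mul_assoc] using this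

/-- Conjugation is linear and continuous, so it suffices to conjugate path projections. -/
theorem S_mem_normalizers (E : DirectedGraph V Ed) (e : Ed) :
    E.univ.S e ∈ normalizers E.diagonal := by
  intro b hb
  have key (m : E.GraphCStar) (hm : ∀ α, m * E.proj α * star m ∈ E.diagonal) :
      m * b * star m ∈ E.diagonal := by
    let T : E.GraphCStar →ₗ[ℂ] E.GraphCStar :=
      LinearMap.mulRight ℂ (star m) ∘ₗ LinearMap.mulLeft ℂ m
    have hT : Continuous T := (continuous_const.mul continuous_id).mul continuous_const
    exact E.diagonal_induction (E.diagonal.toSubmodule.comap T)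
      (E.isClosed_diagonal.preimage hT) hm hb
  refine ⟨key _ fun α => ?_, ?_⟩
  · rcases E.univ.S_mul_pathP_mul_star_S e α with h | ⟨β, h⟩
    · exact h ▸ zero_mem _
    · exact h ▸ E.proj_mem_diagonal β
  · have := key (star (E.univ.S e)) fun α => by
      rw [star_star]
      rcases E.univ.star_S_mul_pathP_mul_S e α with h | ⟨β, h⟩
      · exact h ▸ zero_mem _
      · exact h ▸ E.proj_mem_diagonal β
    rwa [star_star] at this

theorem P_mem_normalizers (E : DirectedGraph V Ed) (x : V) :
    E.univ.P x ∈ normalizers E.diagonal := by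
  intro b hb
  rw [E.univ.star_P]
  exact ⟨mul_mem (mul_mem (E.P_mem_diagonal x) hb) (E.P_mem_diagonal x),
    mul_mem (mul_mem (E.P_mem_diagonal x) hb) (E.P_mem_diagonal x)⟩

theorem pathS_mem_normalizers (E : DirectedGraph V Ed) (α : E.FinPath) :
    E.univ.pathS α ∈ normalizers E.diagonal := by
  obtain ⟨x, l, h⟩ := α
  change E.univ.listS x l ∈ _
  clear h
  induction l generalizing x with
  | nil => exact E.P_mem_normalizers x
  | cons e l ih => exact mul_mem_normalizers (E.S_mem_normalizers e) (ih _)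

/-! ### The approximate unit `q_W` -/

theorem q_mul_self (E : DirectedGraph V Ed) (W : Finset V) : E.q W * E.q W = E.q W :=
  E.q_mul_q subset_rfl

theorem norm_q_le (E : DirectedGraph V Ed) (W : Finset V) : ‖E.q W‖ ≤ 1 := by
  have h1 : ‖E.q W‖ = ‖E.q W‖ * ‖E.q W‖ := by
    rw [← CStarRing.norm_star_mul_self, E.star_q, E.q_mul_self]
  nlinarith [norm_nonneg (E.q W)]

theorem q_mul_P (E : DirectedGraph V Ed) {W : Finset V} {x : V} (hx : x ∈ W) :
    E.q W * E.univ.P x = E.univ.P x := by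
  rw [q, CKFamily.sumP, Finset.sum_mul, Finset.sum_eq_single x, E.univ.P_mul_self]
  · exact fun y _ hy => E.univ.P_orthogonal _ _ hy
  · exact fun h => absurd hx h

/-- The convergence is eventual equality on elements `P x * b`, hence on the generators and their
adjoints; the uniform bound `‖q W‖ ≤ 1` carries it over to limits. -/
theorem tendsto_q_mul (E : DirectedGraph V Ed) (a : E.GraphCStar) :
    Tendsto (fun W => E.q W * a) atTop (𝓝 a) := by
  have hP (x : V) (b : E.GraphCStar) :
      Tendsto (fun W => E.q W * (E.univ.P x * b)) atTop (𝓝 (E.univ.P x * b)) := by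
    refine tendsto_const_nhds.congr' ?_
    filter_upwards [eventually_ge_atTop {x}] with W hW
    rw [← mul_assoc, E.q_mul_P (hW (Finset.mem_singleton_self x))]
  let N : Submodule ℂ E.GraphCStar :=
    { carrier := {a | Tendsto (fun W => E.q W * a) atTop (𝓝 a)}
      add_mem' := fun {a b} ha hb => by
        have := Tendsto.add ha hb
        change Tendsto (fun W => E.q W * (a + b)) atTop (𝓝 (a + b))
        simpa only [← mul_add] using this
      zero_mem' := by
        change Tendsto (fun W => E.q W * 0) atTop (𝓝 0)
        simp only [mul_zero]
        exact tendsto_const_nhds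
      smul_mem' := fun c a ha => by
        have := Tendsto.const_smul ha c
        change Tendsto (fun W => E.q W * (c • a)) atTop (𝓝 (c • a))
        simpa only [← mul_smul_comm] using this }
  have hmem {a : E.GraphCStar} : a ∈ N ↔ Tendsto (fun W => E.q W * a) atTop (𝓝 a) := Iff.rfl
  have hN : IsClosed (N : Set E.GraphCStar) := by
    classical
    refine isClosed_of_closure_subset fun a ha => ?_
    rw [SetLike.mem_coe, hmem, Metric.tendsto_atTop]
    intro ε hε
    obtain ⟨b, hb, hab⟩ := Metric.mem_closure_iff.1 ha (ε / 3) (by positivity)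
    obtain ⟨W₀, hW₀⟩ := Metric.tendsto_atTop.1 (hmem.1 hb) (ε / 3) (by positivity)
    refine ⟨W₀, fun W hW => ?_⟩
    have h1 := hW₀ W hW
    have h2 : ‖E.q W * (a - b)‖ ≤ ‖a - b‖ :=
      (norm_mul_le _ _).trans (mul_le_of_le_one_left (norm_nonneg _) (E.norm_q_le W))
    rw [dist_eq_norm] at h1 hab ⊢
    have h3 : E.q W * a - a = E.q W * (a - b) + (E.q W * b - b) - (a - b) := by
      rw [mul_sub]; abel
    rw [h3]
    calc _ ≤ ‖E.q W * (a - b)‖ + ‖E.q W * b - b‖ + ‖a - b‖ :=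
          (norm_sub_le _ _).trans (add_le_add_left (norm_add_le _ _) _)
      _ < ε := by linarith
  -- `N` is a right ideal and not visibly closed under adjoints; its elements whose adjoint is also
  -- in `N` form a ⋆-subalgebra.
  let M : NonUnitalStarSubalgebra ℂ E.GraphCStar :=
    { carrier := {a | a ∈ N ∧ star a ∈ N}
      add_mem' := fun {a b} ha hb => ⟨add_mem ha.1 hb.1, by
        rw [star_add]; exact add_mem ha.2 hb.2⟩
      zero_mem' := ⟨zero_mem _, by rw [star_zero]; exact zero_mem _⟩
      mul_mem' := fun {a b} ha hb => by
        have key {c d : E.GraphCStar} (hc : c ∈ N) : c * d ∈ N := by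
          rw [hmem] at hc ⊢
          have := hc.mul_const d
          simpa only [mul_assoc] using this
        exact ⟨key ha.1, by rw [star_mul]; exact key hb.2⟩
      smul_mem' := fun c a ha => ⟨N.smul_mem c ha.1, by
        rw [star_smul]; exact N.smul_mem _ ha.2⟩
      star_mem' := fun {a} ha => ⟨ha.2, by rw [star_star]; exact ha.1⟩ }
  have hM : IsClosed (M : Set E.GraphCStar) :=
    hN.inter (hN.preimage continuous_star)
  refine (E.graphCStar_mem_of_generators M hM (fun e => ⟨?_, ?_⟩) (fun x => ⟨?_, ?_⟩) a).1
  · have := hP (E.r e) (E.univ.S e)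
    rwa [E.univ.P_mul_S] at this
  · have := hP (E.s e) (star (E.univ.S e))
    rwa [E.univ.P_mul_star_S] at this
  · have := hP x (E.univ.P x)
    rwa [E.univ.P_mul_self] at this
  · have := hP x (E.univ.P x)
    rwa [E.univ.P_mul_self, ← E.univ.star_P] at this

/-- $n^*n$ is the limit of $n^*q_Wn$, and these lie in the diagonal because $q_W$ does. This
provides the membership required in the definition of full invariance. -/
theorem star_mul_self_mem_diagonal (E : DirectedGraph V Ed) {n : E.GraphCStar}
    (hn : n ∈ normalizers E.diagonal) : star n * n ∈ E.diagonal := by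
  have h := (E.tendsto_q_mul n).const_mul (star n)
  simp only [← mul_assoc] at h
  exact E.isClosed_diagonal.mem_of_tendsto h
    (Eventually.of_forall fun W => (hn _ (E.q_mem_diagonal W)).2)

/-! ### Corners and positive functionals -/

theorem mem_corner_iff (E : DirectedGraph V Ed) (W : Finset V) {a : E.GraphCStar} :
    a ∈ E.corner W ↔ a ∈ E.diagonal ∧ a * E.q W = a := by
  constructor
  · rintro ⟨d, hd, rfl⟩
    exact ⟨mul_mem hd (E.q_mem_diagonal W), by rw [mul_assoc, E.q_mul_self]⟩
  · rintro ⟨h1, h2⟩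
    exact ⟨a, h1, h2.symm⟩

/-- Closedness makes the corner a C⋆-algebra, so that positive functionals on it are bounded. -/
theorem isClosed_corner (E : DirectedGraph V Ed) (W : Finset V) :
    IsClosed (E.corner W : Set E.GraphCStar) := by
  have : (E.corner W : Set E.GraphCStar) = (E.diagonal : Set E.GraphCStar) ∩
      {a | a * E.q W = a} := by
    ext a
    exact E.mem_corner_iff W
  rw [this]
  exact E.isClosed_diagonal.inter
    (isClosed_eq (continuous_id.mul continuous_const) continuous_id)

theorem q_mem_corner (E : DirectedGraph V Ed) (W : Finset V) : E.q W ∈ E.corner W :=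
  (E.mem_corner_iff W).2 ⟨E.q_mem_diagonal W, E.q_mul_self W⟩

theorem proj_mul_q (E : DirectedGraph V Ed) (α : E.FinPath) (W : Finset V) :
    E.proj α * E.q W = E.proj α ∨ E.proj α * E.q W = 0 := by
  rw [proj, ← E.univ.pathP_mul_P, mul_assoc, ← E.commute_q W (E.P_mem_diagonal _)]
  by_cases h : α.range ∈ W
  · left
    rw [E.q_mul_P h]
  · right
    rw [q, CKFamily.sumP, Finset.sum_mul, Finset.sum_eq_zero, mul_zero]
    exact fun y hy => E.univ.P_orthogonal _ _ fun hyx => h (hyx ▸ hy)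

end DirectedGraph

/-- A positive linear functional on a C⋆-algebra is bounded. -/
theorem IsPositiveFunctional.exists_bound {A : Type w} [NonUnitalCStarAlgebra A]
    {f : A →ₗ[ℂ] ℂ} (hf : IsPositiveFunctional f) : ∃ C : ℝ, ∀ a, ‖f a‖ ≤ C * ‖a‖ := by
  let _ := CStarAlgebra.spectralOrder A
  have _ := CStarAlgebra.spectralOrderedRing A
  obtain ⟨C, hC⟩ := PositiveLinearMap.exists_norm_apply_le (PositiveLinearMap.mk₀ f fun a ha => by
    obtain ⟨b, rfl⟩ := CStarAlgebra.nonneg_iff_eq_star_mul_self.1 ha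
    exact hf b)
  exact ⟨C, hC⟩

/-! ### Hermitian symmetry and Cauchy–Schwarz for positive functionals -/

section CauchySchwarz

variable {M : Type w} [NonUnitalRing M] [StarRing M] [Module ℂ M] [IsScalarTower ℂ M M]
  [SMulCommClass ℂ M M] [StarModule ℂ M]

/-- Polarization: the values at $c^*c$ are real for $c=a+b$ and $c=a+ib$, which gives the imaginary
and the real part of the identity. No unit is needed. -/
theorem IsPositiveFunctional.map_star_mul {f : M →ₗ[ℂ] ℂ} (hf : IsPositiveFunctional f) (a b : M) :
    f (star a * b) = star (f (star b * a)) := by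
  have h0 (c : M) : (f (star c * c)).im = 0 := (Complex.nonneg_iff.1 (hf c)).2.symm
  have h1 := h0 (a + b)
  have h2 := h0 (a + Complex.I • b)
  simp only [star_add, star_smul, add_mul, mul_add, smul_mul_assoc, mul_smul_comm, map_add,
    map_smul, Complex.add_im, h0, smul_eq_mul, Complex.star_def, Complex.conj_I, Complex.mul_im,
    Complex.neg_re, Complex.neg_im, Complex.I_re, Complex.I_im, Complex.mul_re] at h1 h2
  apply Complex.ext
  · simp only [Complex.star_def, Complex.conj_re]
    linarith
  · simp only [Complex.star_def, Complex.conj_im]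
    linarith

/-- The Cauchy–Schwarz inequality. -/
theorem IsPositiveFunctional.norm_map_star_mul_sq_le {f : M →ₗ[ℂ] ℂ}
    (hf : IsPositiveFunctional f) (a b : M) :
    ‖f (star a * b)‖ ^ 2 ≤ (f (star a * a)).re * (f (star b * b)).re := by
  let c : PreInnerProductSpace.Core ℂ M :=
    { inner a b := f (star a * b)
      conj_inner_symm a b := (hf.map_star_mul a b).symm
      re_inner_nonneg a := (Complex.nonneg_iff.1 (hf a)).1
      add_left a b c := by rw [star_add, add_mul, map_add]
      smul_left a b r := by rw [star_smul, smul_mul_assoc, map_smul]; rfl }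
  have h := InnerProductSpace.Core.inner_mul_inner_self_le (c := c) a b
  have h2 : ‖f (star b * a)‖ = ‖f (star a * b)‖ := by rw [hf.map_star_mul a b, norm_star]
  rw [sq]
  change ‖f (star a * b)‖ * ‖f (star b * a)‖ ≤ _ at h
  rwa [h2] at h

end CauchySchwarz

/-! ### Invariant families of vertex functionals -/

namespace DirectedGraph

variable {V : Type u} {Ed : Type v}

/-- The number `c` is the defect in the graph trace inequality at `x`, the mass that does not come
from incoming edges. -/
theorem hasSum_of_mem_graphTraces {E : DirectedGraph V Ed} {g : V → ℝ≥0} (hg : g ∈ E.graphTraces)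
    (x : V) : ∃ c : ℝ, 0 ≤ c ∧ (E.IsRegular x → c = 0) ∧
      HasSum (fun e : {e // E.r e = x} => (g (E.s e) : ℝ)) (g x - c) := by
  have h1 := hg.1 x
  have hs : Summable fun e : {e // E.r e = x} => g (E.s e) :=
    ENNReal.tsum_coe_ne_top_iff_summable.1 (ne_top_of_le_ne_top ENNReal.coe_ne_top h1)
  have h2 : ((∑' e : {e // E.r e = x}, g (E.s e) : ℝ≥0) : ℝ≥0∞) =
      ∑' e : {e // E.r e = x}, (g (E.s e) : ℝ≥0∞) := ENNReal.coe_tsum hs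
  refine ⟨g x - (∑' e : {e // E.r e = x}, g (E.s e) : ℝ≥0), ?_, fun hx => ?_, ?_⟩
  · rw [← h2, ENNReal.coe_le_coe] at h1
    exact sub_nonneg.2 (NNReal.coe_le_coe.2 h1)
  · have h3 := hg.2 x hx
    rw [← h2, ENNReal.coe_inj] at h3
    rw [h3, sub_self]
  · rw [sub_sub_cancel]
    exact NNReal.hasSum_coe.2 hs.hasSum

theorem IsVertexFunctional.map_P_mul_of_ne {E : DirectedGraph V Ed} {x y : V} {t : ℝ}
    {φ : E.GraphCStar →L[ℂ] ℂ} (h : E.IsVertexFunctional x t φ) (hxy : x ≠ y)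
    (a : E.GraphCStar) : φ (E.univ.P y * a) = 0 := by
  rw [← h.map_P_mul, ← mul_assoc, E.univ.P_orthogonal _ _ hxy, zero_mul, map_zero]

theorem IsVertexFunctional.map_mul_P_of_ne {E : DirectedGraph V Ed} {x y : V} {t : ℝ}
    {φ : E.GraphCStar →L[ℂ] ℂ} (h : E.IsVertexFunctional x t φ) (hxy : x ≠ y)
    (a : E.GraphCStar) : φ (a * E.univ.P y) = 0 := by
  rw [← star_star (a * E.univ.P y), h.map_star, star_mul, E.univ.star_P, h.map_P_mul_of_ne hxy,
    star_zero]

/-- Given vertex functionals `φ x` of mass `g x`, the functionals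
`φ' x = c_x κ_x + ∑_{r(e) = x} φ (s e) ∘ Ad s_e^*`, with `κ_x` a vertex state and
`c_x = g x - ∑_{r(e) = x} g (s e)`, are vertex functionals of the same masses. -/
theorem exists_vertexFunctional_transfer [Countable Ed] {E : DirectedGraph V Ed} {g : V → ℝ≥0}
    (hg : g ∈ E.graphTraces) {φ : V → E.GraphCStar →L[ℂ] ℂ}
    (hφ : ∀ x, E.IsVertexFunctional x (g x) (φ x)) :
    ∃ φ' : V → E.GraphCStar →L[ℂ] ℂ, (∀ x, E.IsVertexFunctional x (g x) (φ' x)) ∧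
      ∀ f a, φ' (E.r f) (E.univ.S f * a) = φ (E.s f) (a * E.univ.S f) := by
  choose κ hκ hκ0 using E.exists_vertexState
  choose c hc hc0 hcs using hasSum_of_mem_graphTraces hg
  let t (e : Ed) (a : E.GraphCStar) : ℂ :=
    φ (E.s e) (star (E.univ.S e) * (a * E.univ.S e))
  have ht (e : Ed) (a : E.GraphCStar) : ‖t e a‖ ≤ g (E.s e) * ‖a‖ := by
    refine ((hφ (E.s e)).bound _).trans (mul_le_mul_of_nonneg_left ?_ (g (E.s e)).2)
    have h1 := E.univ.norm_S_le e
    calc ‖star (E.univ.S e) * (a * E.univ.S e)‖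
        ≤ ‖star (E.univ.S e)‖ * (‖a‖ * ‖E.univ.S e‖) :=
          (norm_mul_le _ _).trans (mul_le_mul_of_nonneg_left (norm_mul_le _ _) (norm_nonneg _))
      _ ≤ 1 * (‖a‖ * 1) := by
          rw [norm_star]
          gcongr
      _ = ‖a‖ := by ring
  have hts (x : V) (a : E.GraphCStar) : Summable fun e : {e // E.r e = x} => t e a :=
    Summable.of_norm_bounded ((hcs x).summable.mul_right ‖a‖) fun e => ht e a
  have hbound (x : V) (a : E.GraphCStar) :
      ‖(c x : ℂ) * κ x a + ∑' e : {e // E.r e = x}, t e a‖ ≤ g x * ‖a‖ := by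
    have h1 : ‖∑' e : {e // E.r e = x}, t e a‖ ≤ (g x - c x) * ‖a‖ :=
      tsum_of_norm_bounded ((hcs x).mul_right ‖a‖) fun e => ht e a
    have h2 : ‖(c x : ℂ) * κ x a‖ ≤ c x * ‖a‖ := by
      rw [norm_mul, Complex.norm_real, Real.norm_of_nonneg (hc x)]
      have := (hκ x).bound a
      rw [one_mul] at this
      exact mul_le_mul_of_nonneg_left this (hc x)
    calc _ ≤ c x * ‖a‖ + (g x - c x) * ‖a‖ := (norm_add_le _ _).trans (add_le_add h2 h1)
      _ = g x * ‖a‖ := by ring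
  let φ' (x : V) : E.GraphCStar →L[ℂ] ℂ := LinearMap.mkContinuous
    { toFun a := (c x : ℂ) * κ x a + ∑' e : {e // E.r e = x}, t e a
      map_add' a b := by
        have h (e : Ed) : t e (a + b) = t e a + t e b := by
          simp only [t, add_mul, mul_add, map_add]
        simp only [h, map_add]
        rw [(hts x a).tsum_add (hts x b)]
        ring
      map_smul' z a := by
        have h (e : Ed) : t e (z • a) = z * t e a := by
          simp only [t, smul_mul_assoc, mul_smul_comm, map_smul, smul_eq_mul]
        simp only [h, map_smul, smul_eq_mul, RingHom.id_apply]
        rw [tsum_mul_left]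
        ring } (g x) (hbound x)
  have hφ' (x : V) (a : E.GraphCStar) :
      φ' x a = (c x : ℂ) * κ x a + ∑' e : {e // E.r e = x}, t e a := rfl
  refine ⟨φ', fun x => ⟨fun a => ?_, fun a => ?_, hbound x, ?_, fun a => ?_⟩, fun f a => ?_⟩
  · rw [hφ']
    refine add_nonneg (mul_nonneg (by exact_mod_cast hc x) ((hκ x).pos a))
      (tsum_nonneg fun e => ?_)
    -- Each summand is positive because $s_e^*a^*as_e=(as_e)^*(as_e)$.
    have := (hφ (E.s e)).pos (a * E.univ.S e)
    rw [star_mul, mul_assoc, ← mul_assoc (star a), mul_assoc (star a)] at this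
    simpa only [t, mul_assoc] using this
  · have h (e : Ed) : t e (star a) = star (t e a) := by
      simp only [t]
      rw [← (hφ _).map_star, star_mul, star_star, star_mul, mul_assoc]
    rw [hφ', hφ', star_add, star_mul, (hκ x).map_star]
    simp only [h, Complex.star_def, Complex.conj_ofReal]
    rw [Complex.conj_tsum, mul_comm]
  · have h (e : {e // E.r e = x}) : t e (E.univ.P x) = ((g (E.s e) : ℝ) : ℂ) := by
      obtain ⟨e, rfl⟩ := e
      simp only [t]
      rw [E.univ.P_mul_S, E.univ.star_S_mul_S, (hφ _).map_P]
    rw [hφ']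
    simp only [h]
    rw [← Complex.ofReal_tsum, (hcs x).tsum_eq, (hκ x).map_P]
    push_cast
    ring
  · have h (e : {e // E.r e = x}) : t e (E.univ.P x * a) = t e a := by
      obtain ⟨e, rfl⟩ := e
      simp only [t]
      rw [mul_assoc, ← mul_assoc _ (E.univ.P _), E.univ.star_S_mul_P]
    rw [hφ', hφ', (hκ x).map_P_mul]
    simp only [h]
  -- Since $s_e^*s_f=0$ for $e\ne f$, only the summand of `f` survives. The defect term vanishes
  -- too: its coefficient is zero at a regular vertex, and its state kills $s_fa$ elsewhere.
  · rw [hφ', tsum_eq_single ⟨f, rfl⟩]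
    · have h1 : (c (E.r f) : ℂ) * κ (E.r f) (E.univ.S f * a) = 0 := by
        by_cases hf : E.IsRegular (E.r f)
        · rw [hc0 _ hf, Complex.ofReal_zero, zero_mul]
        · rw [hκ0 _ hf, mul_zero]
      rw [h1, zero_add]
      simp only [t]
      rw [mul_assoc, ← mul_assoc, E.univ.star_S_mul_S, (hφ _).map_P_mul]
    · intro e he
      have hne : e.1 ≠ f := fun h => he (Subtype.ext h)
      simp only [t]
      rw [mul_assoc, ← mul_assoc, E.univ.star_S_mul_S_of_ne hne, zero_mul, map_zero]

/-- A family of vertex functionals of masses `g x` that is invariant under the edges. -/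
structure IsTracialFamily (E : DirectedGraph V Ed) (g : V → ℝ≥0)
    (ω : V → E.GraphCStar →L[ℂ] ℂ) : Prop where
  isVertexFunctional : ∀ x, E.IsVertexFunctional x (g x) (ω x)
  map_S_mul : ∀ f a, ω (E.r f) (E.univ.S f * a) = ω (E.s f) (a * E.univ.S f)

/-- A Markov–Kakutani argument: iterate the transfer from the family `g x • κ x` and average. All
conditions on vertex functionals survive means and pointwise limits, and the invariance defect of
the means tends to zero. -/
theorem exists_isTracialFamily [Countable Ed] {E : DirectedGraph V Ed} {g : V → ℝ≥0}
    (hg : g ∈ E.graphTraces) : ∃ ω : V → E.GraphCStar →L[ℂ] ℂ, E.IsTracialFamily g ω := by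
  choose κ hκ _ using E.exists_vertexState
  let Fam := {φ : V → E.GraphCStar →L[ℂ] ℂ // ∀ x, E.IsVertexFunctional x (g x) (φ x)}
  let φ₀ : Fam := ⟨fun x => ((g x : ℝ) : ℂ) • κ x, fun x =>
    ⟨fun a => mul_nonneg (by exact_mod_cast (g x).2) ((hκ x).pos a),
      fun a => by
        simp only [smul_apply, smul_eq_mul, star_mul', (hκ x).map_star, Complex.star_def,
          Complex.conj_ofReal],
      fun a => by
        have := (hκ x).bound a
        rw [one_mul] at this
        rw [smul_apply, smul_eq_mul, norm_mul, Complex.norm_real,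
          Real.norm_of_nonneg (g x).coe_nonneg]
        exact mul_le_mul_of_nonneg_left this (g x).2,
      by rw [smul_apply, (hκ x).map_P, smul_eq_mul, Complex.ofReal_one, mul_one],
      fun a => by rw [smul_apply, smul_apply, (hκ x).map_P_mul]⟩⟩
  have hstep (φ : Fam) : ∃ φ' : Fam,
      ∀ f a, φ'.1 (E.r f) (E.univ.S f * a) = φ.1 (E.s f) (a * E.univ.S f) := by
    obtain ⟨φ', h1, h2⟩ := exists_vertexFunctional_transfer hg φ.2
    exact ⟨⟨φ', h1⟩, h2⟩
  choose T hT using hstep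
  let Φ (n : ℕ) : Fam := T^[n] φ₀
  have hΦ (n : ℕ) (f : Ed) (a : E.GraphCStar) : (Φ (n + 1)).1 (E.r f) (E.univ.S f * a) =
      (Φ n).1 (E.s f) (a * E.univ.S f) := by
    simp only [Φ, Function.iterate_succ_apply']
    exact hT _ f a
  let m (N : ℕ) (x : V) (a : E.GraphCStar) : ℂ :=
    ((N + 1 : ℕ) : ℂ)⁻¹ * ∑ n ∈ Finset.range (N + 1), (Φ n).1 x a
  have hconst (N : ℕ) (z : ℂ) : ((N + 1 : ℕ) : ℂ)⁻¹ * ∑ n ∈ Finset.range (N + 1), z = z := by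
    rw [Finset.sum_const, Finset.card_range, nsmul_eq_mul,
      inv_mul_cancel_left₀ (Nat.cast_ne_zero.2 N.succ_ne_zero)]
  have hbound (N : ℕ) (x : V) (a : E.GraphCStar) : ‖m N x a‖ ≤ g x * ‖a‖ := by
    have h1 : ‖∑ n ∈ Finset.range (N + 1), (Φ n).1 x a‖ ≤ (N + 1 : ℕ) * (g x * ‖a‖) := by
      refine (norm_sum_le_of_le _ fun n _ => ((Φ n).2 x).bound a).trans_eq ?_
      rw [Finset.sum_const, Finset.card_range, nsmul_eq_mul]
    simp only [m]
    rw [norm_mul, norm_inv, Complex.norm_natCast, inv_mul_le_iff₀ (by positivity)]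
    exact h1
  -- One free ultrafilter gives limits of the bounded means for all `x` and `a` at once, so the
  -- limit is linear in `a`.
  let U : Ultrafilter ℕ := hyperfilter ℕ
  have hU : (U : Filter ℕ) ≤ atTop := Nat.hyperfilter_le_atTop
  have hlim (x : V) (a : E.GraphCStar) : ∃ l, Tendsto (fun N => m N x a) U (𝓝 l) := by
    have hmem : Metric.closedBall (0 : ℂ) (g x * ‖a‖) ∈ U.map fun N => m N x a :=
      Ultrafilter.mem_map.2 (univ_mem' fun N => mem_closedBall_zero_iff.2 (hbound N x a))
    obtain ⟨l, -, hl⟩ := (isCompact_closedBall (0 : ℂ) (g x * ‖a‖)).ultrafilter_le_nhds'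
      (U.map fun N => m N x a) hmem
    exact ⟨l, hl⟩
  choose l hl using hlim
  have hlb (x : V) (a : E.GraphCStar) : ‖l x a‖ ≤ g x * ‖a‖ :=
    le_of_tendsto (hl x a).norm (Eventually.of_forall fun N => hbound N x a)
  let ω (x : V) : E.GraphCStar →L[ℂ] ℂ := LinearMap.mkContinuous
    { toFun a := l x a
      map_add' a b := by
        refine tendsto_nhds_unique (hl x (a + b)) (((hl x a).add (hl x b)).congr fun N => ?_)
        simp only [m, map_add, Finset.sum_add_distrib, mul_add]
      map_smul' z a := by
        refine tendsto_nhds_unique (hl x (z • a)) (((hl x a).const_mul z).congr fun N => ?_)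
        simp only [m, map_smul, smul_eq_mul, ← Finset.mul_sum]
        ring } (g x) (hlb x)
  have hω (x : V) (a : E.GraphCStar) : Tendsto (fun N => m N x a) U (𝓝 (ω x a)) := hl x a
  refine ⟨ω, fun x => ⟨fun a => ?_, fun a => ?_, hlb x, ?_, fun a => ?_⟩, fun f a => ?_⟩
  · refine ge_of_tendsto (hω x _) (Eventually.of_forall fun N => ?_)
    refine mul_nonneg ?_ (Finset.sum_nonneg fun n _ => ((Φ n).2 x).pos a)
    rw [inv_nonneg]
    exact Nat.cast_nonneg _
  · refine tendsto_nhds_unique (hω x _) ((hω x a).star.congr fun N => ?_)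
    simp only [m, star_mul', star_inv₀, star_natCast, star_sum, ((Φ _).2 x).map_star]
  · refine tendsto_nhds_unique (hω x _) (tendsto_const_nhds.congr fun N => ?_)
    simp only [m, ((Φ _).2 x).map_P]
    exact (hconst N _).symm
  · refine tendsto_nhds_unique (hω x _) ((hω x a).congr fun N => ?_)
    simp only [m, ((Φ _).2 x).map_P_mul]
  · set C : ℝ := g (E.r f) * ‖E.univ.S f * a‖ + g (E.s f) * ‖a * E.univ.S f‖ with hC
    rw [← sub_eq_zero]
    refine tendsto_nhds_unique ((hω (E.r f) _).sub (hω (E.s f) _)) ?_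
    refine squeeze_zero_norm (a := fun N : ℕ => C / ((N : ℝ) + 1)) (fun N => ?_) ?_
    · simp only [m]
      -- By `hΦ` the two sums telescope: only term `0` at `r f` and term `N` at `s f` remain, and
      -- both are bounded independently of `N`.
      rw [← mul_sub, Finset.sum_range_succ', Finset.sum_range_succ]
      simp only [hΦ]
      rw [add_sub_add_left_eq_sub, norm_mul, norm_inv, Complex.norm_natCast, Nat.cast_succ,
        div_eq_inv_mul]
      refine mul_le_mul_of_nonneg_left ?_ (by positivity)
      exact (norm_sub_le _ _).trans
        (add_le_add (((Φ 0).2 _).bound _) (((Φ N).2 _).bound _))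
    · have h : Tendsto (fun N : ℕ => C / ((N : ℝ) + 1)) atTop (𝓝 0) := by
        have := (tendsto_one_div_add_atTop_nhds_zero_nat (𝕜 := ℝ)).const_mul C
        simpa only [mul_one_div, mul_zero] using this
      exact h.mono_left hU

namespace IsTracialFamily

variable {E : DirectedGraph V Ed} {g : V → ℝ≥0} {ω : V → E.GraphCStar →L[ℂ] ℂ}

theorem map_pathS_mul (hω : E.IsTracialFamily g ω) (α : E.FinPath) (a : E.GraphCStar) :
    ω α.range (E.univ.pathS α * a) = ω α.source (a * E.univ.pathS α) := by
  obtain ⟨x, l, h⟩ := α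
  change ω x (E.univ.listS x l * a) = ω (E.listSource x l) (a * E.univ.listS x l)
  induction l generalizing x a with
  | nil =>
    change ω x (E.univ.P x * a) = ω x (a * E.univ.P x)
    have hx := hω.isVertexFunctional x
    rw [hx.map_P_mul, ← star_star (a * E.univ.P x), hx.map_star, star_mul, E.univ.star_P,
      hx.map_P_mul, ← hx.map_star, star_star]
  | cons e l ih =>
    obtain ⟨rfl, h'⟩ := h
    change ω (E.r e) (E.univ.S e * E.univ.listS (E.s e) l * a) =
      ω (E.listSource (E.s e) l) (a * (E.univ.S e * E.univ.listS (E.s e) l))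
    rw [mul_assoc, hω.map_S_mul, mul_assoc, ih _ _ h', mul_assoc]

theorem map_proj (hω : E.IsTracialFamily g ω) (α : E.FinPath) :
    ω α.range (E.proj α) = ((g α.source : ℝ) : ℂ) := by
  rw [proj, CKFamily.pathP, hω.map_pathS_mul, E.univ.star_pathS_mul_pathS,
    (hω.isVertexFunctional _).map_P]

end IsTracialFamily

end DirectedGraph

namespace DirectedGraph

variable {V : Type u} {Ed : Type v}

theorem diagProj_vertexPath (E : DirectedGraph V Ed) (x : V) :
    E.diagProj (E.vertexPath x) = E.diagP x :=
  Subtype.ext (E.univ.pathP_vertexPath x)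

/-! ### Uniqueness of functionals with given values on the path projections -/

/-- The kernel of the difference is closed and contains all path projections. Neither positivity nor
invariance plays a role. -/
theorem diagonal_functional_ext {E : DirectedGraph V Ed} {φ ψ : E.diagonal →L[ℂ] ℂ}
    (h : ∀ α, φ (E.diagProj α) = ψ (E.diagProj α)) : φ = ψ := by
  let ι : E.diagonal →ₗ[ℂ] E.GraphCStar :=
    { toFun d := d
      map_add' _ _ := rfl
      map_smul' _ _ := rfl }
  let K : Submodule ℂ E.diagonal := LinearMap.ker ((φ - ψ : E.diagonal →L[ℂ] ℂ) : E.diagonal →ₗ[ℂ] ℂ)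
  have hK : IsClosed (K : Set E.diagonal) :=
    isClosed_eq (φ - ψ).continuous continuous_const
  have hN : IsClosed (K.map ι : Set E.GraphCStar) :=
    E.isClosed_diagonal.isClosedEmbedding_subtypeVal.isClosedMap _ hK
  ext d
  obtain ⟨d', hd', hdd⟩ := E.diagonal_induction (K.map ι) hN
    (fun α => ⟨E.diagProj α, sub_eq_zero.2 (h α), rfl⟩) d.2
  obtain rfl : d' = d := Subtype.ext hdd
  exact sub_eq_zero.1 hd'

/-- Positivity on the C⋆-algebra `E.corner W` yields boundedness there; composing with `d ↦ d * q W`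
gives a bounded functional on the whole diagonal, to which `diagonal_functional_ext` applies. -/
theorem exists_clm_eq_on_corner {E : DirectedGraph V Ed} {η : E.diagonalFin →ₗ[ℂ] ℂ}
    (hη : IsPositiveFunctional η) (W : Finset V) : ∃ φ : E.diagonal →L[ℂ] ℂ,
      ∀ d : E.diagonal, φ d = η ⟨d * E.q W, W, d, d.2, rfl⟩ := by
  let _ : NonUnitalCStarAlgebra (E.corner W) :=
    NonUnitalStarSubalgebra.nonUnitalCStarAlgebra (E.corner W) (h_closed := E.isClosed_corner W)
  obtain ⟨C, hC⟩ := IsPositiveFunctional.exists_bound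
    (f := restrictFunctional (E.corner_le_diagonalFin W) η)
    fun a => hη ⟨a, E.corner_le_diagonalFin W a.2⟩
  have hC' (d : E.diagonal) : ‖η ⟨d * E.q W, W, d, d.2, rfl⟩‖ ≤ |C| * ‖d‖ := by
    refine (hC ⟨d * E.q W, d, d.2, rfl⟩).trans ?_
    refine mul_le_mul (le_abs_self C) ?_ (norm_nonneg _) (abs_nonneg C)
    exact (norm_mul_le _ _).trans (mul_le_of_le_one_right (norm_nonneg _) (E.norm_q_le W))
  refine ⟨LinearMap.mkContinuous
    { toFun d := η ⟨d * E.q W, W, d, d.2, rfl⟩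
      map_add' a b := by
        rw [← map_add]
        congr 1
        exact Subtype.ext (add_mul (a : E.GraphCStar) b (E.q W))
      map_smul' c a := by
        rw [RingHom.id_apply, ← map_smul]
        congr 1
        exact Subtype.ext (smul_mul_assoc c (a : E.GraphCStar) (E.q W)) } |C| hC', fun d => rfl⟩

theorem diagonalFin_functional_ext {E : DirectedGraph V Ed} {η η' : E.diagonalFin →ₗ[ℂ] ℂ}
    (hη : IsPositiveFunctional η) (hη' : IsPositiveFunctional η')
    (h : ∀ α, η (E.diagFinProj α) = η' (E.diagFinProj α)) : η = η' := by
  ext ⟨a, W, d, hd, rfl⟩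
  obtain ⟨φ, hφ⟩ := exists_clm_eq_on_corner hη W
  obtain ⟨φ', hφ'⟩ := exists_clm_eq_on_corner hη' W
  have key : φ = φ' := by
    refine diagonal_functional_ext fun α => ?_
    rw [hφ, hφ']
    rcases E.proj_mul_q α W with hα | hα
    · have : (⟨E.diagProj α * E.q W, W, E.diagProj α, (E.diagProj α).2, rfl⟩ : E.diagonalFin) =
          E.diagFinProj α := Subtype.ext hα
      rw [this, h]
    · have : (⟨E.diagProj α * E.q W, W, E.diagProj α, (E.diagProj α).2, rfl⟩ : E.diagonalFin) =
          0 := Subtype.ext hα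
      rw [this, map_zero, map_zero]
  have h1 := hφ ⟨d, hd⟩
  rw [key, hφ'] at h1
  exact h1.symm

/-! ### The functional on `𝒟(E)_fin` -/

theorem sum_le_toReal_norm1 {g : V → ℝ≥0} (h : norm1 g ≠ ∞) (W : Finset V) :
    ∑ x ∈ W, (g x : ℝ) ≤ (norm1 g).toReal := by
  have h1 : ((∑ x ∈ W, g x : ℝ≥0) : ℝ≥0∞) ≤ norm1 g := by
    rw [ENNReal.ofNNReal_finsetSum]
    exact ENNReal.sum_le_tsum W
  have h2 := ENNReal.toReal_mono h h1
  rwa [ENNReal.coe_toReal, NNReal.coe_sum] at h2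

theorem norm1_le_ofReal {g : V → ℝ≥0} {C : ℝ} (h : ∀ W : Finset V, ∑ x ∈ W, (g x : ℝ) ≤ C) :
    norm1 g ≤ ENNReal.ofReal C := by
  rw [norm1, ENNReal.tsum_eq_iSup_sum]
  refine iSup_le fun W => ?_
  rw [← ENNReal.ofNNReal_finsetSum, ← ENNReal.ofReal_coe_nnreal, NNReal.coe_sum]
  exact ENNReal.ofReal_le_ofReal (h W)

theorem toReal_norm1_le {g : V → ℝ≥0} {C : ℝ} (h : ∀ W : Finset V, ∑ x ∈ W, (g x : ℝ) ≤ C) :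
    (norm1 g).toReal ≤ C := by
  have hC : 0 ≤ C := by simpa using h ∅
  exact ENNReal.toReal_le_of_le_ofReal hC (norm1_le_ofReal h)

theorem functionalHasNorm_of_bound {M : Type w} [NonUnitalNormedRing M] [NormedSpace ℂ M]
    {f : M →ₗ[ℂ] ℂ} {c : ℝ} (hc : 0 ≤ c) (hf : ∀ a, ‖f a‖ ≤ c * ‖a‖)
    (h : ∀ C, 0 ≤ C → (∀ a, ‖f a‖ ≤ C * ‖a‖) → c ≤ C) : FunctionalHasNorm f c :=
  ⟨f.mkContinuous c hf, rfl, le_antisymm (f.mkContinuous_norm_le hc hf)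
    (h _ (norm_nonneg _) fun a => (f.mkContinuous c hf).le_opNorm a)⟩

namespace IsTracialFamily

variable {E : DirectedGraph V Ed} {g : V → ℝ≥0} {ω : V → E.GraphCStar →L[ℂ] ℂ}

theorem map_eq_zero_of_mem_corner (hω : E.IsTracialFamily g ω) {W : Finset V} {a : E.GraphCStar}
    (ha : a ∈ E.corner W) {x : V} (hx : x ∉ W) : ω x a = 0 := by
  rw [← ((E.mem_corner_iff W).1 ha).2, q, CKFamily.sumP, Finset.mul_sum, map_sum]
  exact Finset.sum_eq_zero fun y hy =>
    (hω.isVertexFunctional x).map_mul_P_of_ne (fun h => hx (h ▸ hy)) a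

/-- The finitely supported sum does not mention `W`, so the functional on the union of the corners
needs no choice of a corner and no compatibility check. -/
theorem finsum_eq_sum (hω : E.IsTracialFamily g ω) {W : Finset V} {a : E.GraphCStar}
    (ha : a ∈ E.corner W) : ∑ᶠ x, ω x a = ∑ x ∈ W, ω x a := by
  refine finsum_eq_sum_of_support_subset _ fun x hx => ?_
  by_contra h
  exact hx (hω.map_eq_zero_of_mem_corner ha h)

open Classical in
/-- The functional `∑_x ω_x` on `𝒟(E)_fin`. -/
def functionalFin (hω : E.IsTracialFamily g ω) : E.diagonalFin →ₗ[ℂ] ℂ where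
  toFun a := ∑ᶠ x, ω x a
  map_add' := by
    rintro ⟨a, W, ha⟩ ⟨b, W', hb⟩
    have ha' := E.corner_mono (Finset.subset_union_left (s₂ := W')) ha
    have hb' := E.corner_mono (Finset.subset_union_right (s₁ := W)) hb
    change ∑ᶠ x, ω x (a + b) = ∑ᶠ x, ω x a + ∑ᶠ x, ω x b
    rw [hω.finsum_eq_sum ha', hω.finsum_eq_sum hb', hω.finsum_eq_sum (add_mem ha' hb'),
      ← Finset.sum_add_distrib]
    simp only [map_add]
  map_smul' := by
    rintro c ⟨a, W, ha⟩
    change ∑ᶠ x, ω x (c • a) = c * ∑ᶠ x, ω x a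
    rw [hω.finsum_eq_sum ha, hω.finsum_eq_sum (SMulMemClass.smul_mem c ha), Finset.mul_sum]
    simp only [map_smul, smul_eq_mul]

theorem functionalFin_apply (hω : E.IsTracialFamily g ω) {W : Finset V} {a : E.diagonalFin}
    (ha : (a : E.GraphCStar) ∈ E.corner W) : hω.functionalFin a = ∑ x ∈ W, ω x a :=
  hω.finsum_eq_sum ha

theorem isPositiveFunctional_functionalFin (hω : E.IsTracialFamily g ω) :
    IsPositiveFunctional hω.functionalFin := by
  rintro ⟨a, W, ha⟩
  rw [hω.functionalFin_apply (W := W) (mul_mem (star_mem ha) ha)]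
  exact Finset.sum_nonneg fun x _ => (hω.isVertexFunctional x).pos a

theorem functionalFin_diagFinProj (hω : E.IsTracialFamily g ω) (α : E.FinPath) :
    hω.functionalFin (E.diagFinProj α) = ((g α.source : ℝ) : ℂ) := by
  rw [hω.functionalFin_apply (W := {α.range}), Finset.sum_singleton]
  · exact hω.map_proj α
  · rw [mem_corner_iff, q, CKFamily.sumP, Finset.sum_singleton]
    exact ⟨E.proj_mem_diagonal α, E.univ.pathP_mul_P α⟩

theorem sum_map_q (hω : E.IsTracialFamily g ω) (W : Finset V) :
    ∑ x ∈ W, ω x (E.q W) = ((∑ x ∈ W, (g x : ℝ) : ℝ) : ℂ) := by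
  rw [Complex.ofReal_sum]
  refine Finset.sum_congr rfl fun x hx => ?_
  rw [← (hω.isVertexFunctional x).map_P_mul, ← E.commute_q W (E.P_mem_diagonal x), E.q_mul_P hx, (hω.isVertexFunctional x).map_P]

theorem norm_functionalFin_le (hω : E.IsTracialFamily g ω) {W : Finset V} {a : E.diagonalFin}
    (ha : (a : E.GraphCStar) ∈ E.corner W) :
    ‖hω.functionalFin a‖ ≤ (∑ x ∈ W, (g x : ℝ)) * ‖a‖ := by
  rw [hω.functionalFin_apply ha, Finset.sum_mul]
  exact norm_sum_le_of_le _ fun x _ => (hω.isVertexFunctional x).bound a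

/-- The element `q W` has norm at most one, so this value bounds the norm from below, on the corner
and on the whole of `E.diagonalFin`. -/
theorem norm_functionalFin_q (hω : E.IsTracialFamily g ω) (W : Finset V) :
    ‖hω.functionalFin ⟨E.q W, W, E.q_mem_corner W⟩‖ = ∑ x ∈ W, (g x : ℝ) := by
  rw [hω.functionalFin_apply (W := W) (E.q_mem_corner W)]
  change ‖∑ x ∈ W, ω x (E.q W)‖ = _
  rw [hω.sum_map_q, Complex.norm_real]
  exact Real.norm_of_nonneg (Finset.sum_nonneg fun x _ => (g x).2)

theorem functionalHasNorm_restrict (hω : E.IsTracialFamily g ω) (W : Finset V) :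
    FunctionalHasNorm (restrictFunctional (E.corner_le_diagonalFin W) hω.functionalFin)
      (∑ x ∈ W, (g x : ℝ)) := by
  refine functionalHasNorm_of_bound (Finset.sum_nonneg fun x _ => (g x).2) (fun a => ?_) ?_
  · exact hω.norm_functionalFin_le (a := ⟨a, E.corner_le_diagonalFin W a.2⟩) a.2
  · intro C hC h
    rw [← hω.norm_functionalFin_q W]
    exact (h ⟨E.q W, E.q_mem_corner W⟩).trans (mul_le_of_le_one_right hC (E.norm_q_le W))

theorem sum_le_of_bound (hω : E.IsTracialFamily g ω) {C : ℝ} (hC : 0 ≤ C)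
    (h : ∀ a, ‖hω.functionalFin a‖ ≤ C * ‖a‖) (W : Finset V) : ∑ x ∈ W, (g x : ℝ) ≤ C := by
  rw [← hω.norm_functionalFin_q W]
  exact (h _).trans (mul_le_of_le_one_right hC (E.norm_q_le W))

theorem norm_functionalFin_le_norm1 (hω : E.IsTracialFamily g ω) (hg : norm1 g ≠ ∞)
    (a : E.diagonalFin) : ‖hω.functionalFin a‖ ≤ (norm1 g).toReal * ‖a‖ := by
  obtain ⟨W, ha⟩ := a.2
  exact (hω.norm_functionalFin_le ha).trans
    (mul_le_mul_of_nonneg_right (sum_le_toReal_norm1 hg W) (norm_nonneg _))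

theorem continuous_functionalFin_iff (hω : E.IsTracialFamily g ω) :
    Continuous hω.functionalFin ↔ norm1 g ≠ ∞ := by
  constructor
  · intro h
    let F : E.diagonalFin →L[ℂ] ℂ := ⟨hω.functionalFin, h⟩
    exact ne_top_of_le_ne_top ENNReal.ofReal_ne_top
      (norm1_le_ofReal (hω.sum_le_of_bound (norm_nonneg F) F.le_opNorm))
  · intro h
    exact (hω.functionalFin.mkContinuous _ (hω.norm_functionalFin_le_norm1 h)).continuous

theorem functionalHasNorm_functionalFin (hω : E.IsTracialFamily g ω) (hg : norm1 g ≠ ∞) :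
    FunctionalHasNorm hω.functionalFin (norm1 g).toReal :=
  functionalHasNorm_of_bound ENNReal.toReal_nonneg (hω.norm_functionalFin_le_norm1 hg)
    fun _ hC h => toReal_norm1_le (hω.sum_le_of_bound hC h)

/-! ### The tracial functional on `C^*(E)` -/

/-- Summability of `g` makes `∑ x, ω x` converge in norm. The elements commuting with everything
under it form a closed ⋆-subalgebra, and edge invariance puts the generators into it. -/
theorem exists_trace (hω : E.IsTracialFamily g ω) (hg : norm1 g ≠ ∞) :
    ∃ τ : E.GraphCStar →L[ℂ] ℂ, (∀ a, 0 ≤ τ (star a * a)) ∧ (∀ a b, τ (a * b) = τ (b * a)) ∧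
      (∀ α, τ (E.proj α) = ((g α.source : ℝ) : ℂ)) ∧ ∀ a, ‖τ a‖ ≤ (norm1 g).toReal * ‖a‖ := by
  have hv := hω.isVertexFunctional
  have hgs : Summable fun x => (g x : ℝ) :=
    NNReal.summable_coe.2 (ENNReal.tsum_coe_ne_top_iff_summable.1 hg)
  have hgt : HasSum (fun x => (g x : ℝ)) (norm1 g).toReal := by
    have h := hgs.hasSum
    rw [norm1, ENNReal.tsum_toReal_eq fun _ => ENNReal.coe_ne_top]
    exact h
  have hs (a : E.GraphCStar) : Summable fun x => ω x a :=
    Summable.of_norm_bounded (hgs.mul_right ‖a‖) fun x => (hv x).bound a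
  have hb (a : E.GraphCStar) : ‖∑' x, ω x a‖ ≤ (norm1 g).toReal * ‖a‖ :=
    tsum_of_norm_bounded (hgt.mul_right ‖a‖) fun x => (hv x).bound a
  let τ : E.GraphCStar →L[ℂ] ℂ := LinearMap.mkContinuous
    { toFun a := ∑' x, ω x a
      map_add' a b := by
        simp only [map_add]
        exact (hs a).tsum_add (hs b)
      map_smul' c a := by
        simp only [map_smul, smul_eq_mul, RingHom.id_apply]
        exact tsum_mul_left } _ hb
  have hτ (a : E.GraphCStar) : τ a = ∑' x, ω x a := rfl
  have hstar (a : E.GraphCStar) : τ (star a) = star (τ a) := by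
    simp only [hτ, (hv _).map_star, Complex.star_def]
    exact (Complex.conj_tsum _).symm
  have hPl (x : V) (a : E.GraphCStar) : τ (E.univ.P x * a) = ω x a := by
    rw [hτ, tsum_eq_single x fun y hy => (hv y).map_P_mul_of_ne hy a, (hv x).map_P_mul]
  have hPr (x : V) (a : E.GraphCStar) : τ (a * E.univ.P x) = ω x a := by
    rw [← star_star (a * E.univ.P x), hstar, star_mul, E.univ.star_P, hPl, (hv x).map_star,
      star_star]
  let M : NonUnitalStarSubalgebra ℂ E.GraphCStar :=
    { carrier := {a | ∀ b, τ (a * b) = τ (b * a)}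
      add_mem' := fun {a b} ha hb c => by rw [add_mul, mul_add, map_add, map_add, ha, hb]
      zero_mem' := fun c => by rw [zero_mul, mul_zero]
      mul_mem' := fun {a b} ha hb c => by
        rw [mul_assoc, ha, mul_assoc, hb, mul_assoc]
      smul_mem' := fun z a ha c => by
        rw [smul_mul_assoc, mul_smul_comm, map_smul, map_smul, ha]
      star_mem' := fun {a} ha c => by
        rw [← star_star c, ← star_mul, hstar, ← ha, ← hstar, star_mul] }
  have hM : IsClosed (M : Set E.GraphCStar) := by
    have : (M : Set E.GraphCStar) = ⋂ b, {a | τ (a * b) = τ (b * a)} := by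
      ext a
      rw [Set.mem_iInter]
      rfl
    rw [this]
    exact isClosed_iInter fun b => isClosed_eq
      (τ.continuous.comp (continuous_id.mul continuous_const))
      (τ.continuous.comp (continuous_const.mul continuous_id))
  refine ⟨τ, fun a => tsum_nonneg fun x => (hv x).pos a, fun a => ?_, fun α => ?_, hb⟩
  · refine E.graphCStar_mem_of_generators M hM (fun e b => ?_) (fun x b => ?_) a
    -- The vertex projection at `r e` selects the summand `ω (r e)`, invariance passes to `ω (s e)`,
    -- and the projection at `s e` is absorbed back into the full sum.
    · rw [← E.univ.P_mul_S, mul_assoc, hPl, hω.map_S_mul, E.univ.P_mul_S, ← E.univ.S_mul_P e,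
        ← mul_assoc, hPr, mul_assoc, E.univ.S_mul_P]
    · rw [hPl, hPr]
  · rw [proj, ← E.univ.P_mul_pathP, hPl]
    exact hω.map_proj α

end IsTracialFamily

/-! ### Fully invariant states -/

theorem functional_q_eq_sum {E : DirectedGraph V Ed} (φ : E.diagonal →L[ℂ] ℂ) {g : V → ℝ≥0}
    (h : ∀ x, φ (E.diagP x) = ((g x : ℝ) : ℂ)) (W : Finset V) :
    φ ⟨E.q W, E.q_mem_diagonal W⟩ = ((∑ x ∈ W, (g x : ℝ) : ℝ) : ℂ) := by
  have : (⟨E.q W, E.q_mem_diagonal W⟩ : E.diagonal) = ∑ x ∈ W, E.diagP x := by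
    refine Subtype.ext ?_
    rw [AddSubmonoidClass.coe_finsetSum]
    rfl
  rw [this, map_sum, Complex.ofReal_sum]
  exact Finset.sum_congr rfl fun x _ => h x

/-- The state is the restriction of the trace on $C^*(E)$; full invariance is then the identity
$\tau(nbn^*)=\tau(n^*nb)$. The lower norm bound comes from the values at `q W`. -/
theorem exists_fullyInvariantState [Countable Ed] {E : DirectedGraph V Ed} {g : V → ℝ≥0}
    (hg : g ∈ E.normalizedGraphTraces) : ∃ ψ ∈ fullyInvariantStates E.diagonal,
      ∀ α, ψ (E.diagProj α) = ((g α.source : ℝ) : ℂ) := by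
  obtain ⟨ω, hω⟩ := exists_isTracialFamily hg.1
  obtain ⟨τ, hpos, htr, hτ, hb⟩ := hω.exists_trace (by rw [hg.2]; exact ENNReal.one_ne_top)
  rw [hg.2, ENNReal.toReal_one] at hb
  let ψ : E.diagonal →L[ℂ] ℂ := LinearMap.mkContinuous
    { toFun d := τ d
      map_add' a b := map_add τ (a : E.GraphCStar) b
      map_smul' c a := map_smul τ c (a : E.GraphCStar) } 1 fun d => hb d
  refine ⟨ψ, ⟨⟨fun a => hpos a, le_antisymm ?_ ?_⟩, fun n hn b => ?_⟩, fun α => hτ α⟩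
  · exact LinearMap.mkContinuous_norm_le _ zero_le_one _
  · rw [← ENNReal.toReal_one, ← hg.2]
    refine toReal_norm1_le fun W => ?_
    have h1 := functional_q_eq_sum ψ (g := g)
      (fun x => by rw [← diagProj_vertexPath]; exact hτ _) W
    have h2 := ψ.le_opNorm ⟨E.q W, E.q_mem_diagonal W⟩
    rw [h1, Complex.norm_real] at h2
    exact (le_abs_self _).trans
      (h2.trans (mul_le_of_le_one_right (norm_nonneg _) (E.norm_q_le W)))
  · refine ⟨mul_mem (E.star_mul_self_mem_diagonal hn) b.2, ?_⟩
    change τ (n * b * star n) = τ (star n * n * b)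
    rw [htr, mul_assoc]

theorem functional_nonneg_of_star_mul_self_eq {E : DirectedGraph V Ed} {φ : E.diagonal →L[ℂ] ℂ}
    (hφ : IsPositiveFunctional (φ : E.diagonal →ₗ[ℂ] ℂ)) {d : E.diagonal}
    (hd : star (d : E.GraphCStar) * d = d) : 0 ≤ φ d := by
  have h : star d * d = d := Subtype.ext hd
  have := hφ d
  rwa [h] at this

/-- The function `x ↦ θ(p_x)` of a positive functional `θ` on `𝒟(E)`. -/
def vertexWeight {E : DirectedGraph V Ed} (θ : E.diagonal →L[ℂ] ℂ) (x : V) : ℝ≥0 :=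
  (θ (E.diagP x)).re.toNNReal

section VertexWeight

variable {E : DirectedGraph V Ed} {θ : E.diagonal →L[ℂ] ℂ}

theorem coe_vertexWeight (hθ : IsPositiveFunctional (θ : E.diagonal →ₗ[ℂ] ℂ)) (x : V) :
    ((vertexWeight θ x : ℝ) : ℂ) = θ (E.diagP x) := by
  have h : 0 ≤ θ (E.diagP x) := functional_nonneg_of_star_mul_self_eq hθ
    (by change star (E.univ.P x) * E.univ.P x = _; rw [E.univ.star_P, E.univ.P_mul_self]; rfl)
  rw [vertexWeight, Real.coe_toNNReal _ (Complex.nonneg_iff.1 h).1]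
  exact Complex.ext rfl (Complex.nonneg_iff.1 h).2

/-- Invariance is applied to the normalizer $n=s_\alpha$ and $b=p_{s(\alpha)}$, for which
$nbn^*=p_\alpha$ and $n^*nb=p_{s(\alpha)}$. -/
theorem map_diagProj_eq_vertexWeight (hθ : θ ∈ fullyInvariantStates E.diagonal) (α : E.FinPath) :
    θ (E.diagProj α) = ((vertexWeight θ α.source : ℝ) : ℂ) := by
  obtain ⟨h, h'⟩ := hθ.2 _ (E.pathS_mem_normalizers α) (E.diagP α.source)
  rw [coe_vertexWeight hθ.1.1]
  have h1 : E.univ.pathS α * E.diagP α.source * star (E.univ.pathS α) = E.proj α := by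
    change E.univ.pathS α * E.univ.P α.source * star (E.univ.pathS α) = _
    rw [E.univ.pathS_mul_P]
    rfl
  have h2 : star (E.univ.pathS α) * E.univ.pathS α * E.diagP α.source = E.univ.P α.source := by
    rw [E.univ.star_pathS_mul_pathS]
    exact E.univ.P_mul_self _
  simp only [h1, h2] at h'
  exact h'

/-- An edge, regarded as a path of length one. -/
def edgePath (E : DirectedGraph V Ed) (e : Ed) : E.FinPath := ⟨E.r e, [e], rfl, trivial⟩

theorem proj_edgePath (E : DirectedGraph V Ed) (e : Ed) :
    E.proj (E.edgePath e) = E.univ.S e * star (E.univ.S e) := by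
  change E.univ.S e * E.univ.P (E.s e) * star (E.univ.S e * E.univ.P (E.s e)) = _
  rw [E.univ.S_mul_P]

/-- The edge projections are mutually orthogonal and lie under $p_x$, so the difference is a
projection. Its positivity under a state is the graph trace inequality for finitely many edges. -/
theorem star_mul_self_sub_sum_edges (E : DirectedGraph V Ed) (x : V) (F : Finset Ed)
    (hF : ∀ e ∈ F, E.r e = x) :
    star (E.univ.P x - ∑ e ∈ F, E.proj (E.edgePath e)) *
      (E.univ.P x - ∑ e ∈ F, E.proj (E.edgePath e)) =
        E.univ.P x - ∑ e ∈ F, E.proj (E.edgePath e) := by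
  set R := ∑ e ∈ F, E.proj (E.edgePath e) with hR
  have h1 : star R = R := by
    rw [hR, star_sum]
    exact Finset.sum_congr rfl fun e _ => E.univ.star_pathP _
  have h2 : E.univ.P x * R = R := by
    rw [hR, Finset.mul_sum]
    refine Finset.sum_congr rfl fun e he => ?_
    rw [← hF e he]
    exact E.univ.P_mul_pathP (E.edgePath e)
  have h3 : R * E.univ.P x = R := by
    have := congrArg star h2
    rwa [star_mul, h1, E.univ.star_P] at this
  have h4 : R * R = R := by
    conv_lhs => rw [hR]
    rw [Finset.sum_mul]
    refine Finset.sum_congr rfl fun e he => ?_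
    rw [Finset.mul_sum, Finset.sum_eq_single e]
    · rw [proj_edgePath, ← mul_assoc, E.univ.S_partialIsometry]
    · intro f _ hf
      rw [proj_edgePath, proj_edgePath, E.univ.S_orthogonal _ _ (Ne.symm hf)]
    · exact fun h => absurd he h
  rw [star_sub, h1, E.univ.star_P, sub_mul, mul_sub, mul_sub, h2, h3, h4, E.univ.P_mul_self]
  abel

/-- The inequality is checked on finite sets of edges, whose supremum is the sum in $[0,\infty]$; at
a regular vertex the Cuntz–Krieger relation gives equality. -/
theorem vertexWeight_mem_graphTraces (hθ : θ ∈ fullyInvariantStates E.diagonal) :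
    vertexWeight θ ∈ E.graphTraces := by
  have hsum (F : Finset Ed) : θ (∑ e ∈ F, E.diagProj (E.edgePath e)) =
      ((∑ e ∈ F, (vertexWeight θ (E.s e) : ℝ) : ℝ) : ℂ) := by
    rw [map_sum, Complex.ofReal_sum]
    exact Finset.sum_congr rfl fun e _ => map_diagProj_eq_vertexWeight hθ _
  have hcoe (F : Finset Ed) : ((∑ e ∈ F, E.diagProj (E.edgePath e) : E.diagonal) : E.GraphCStar) =
      ∑ e ∈ F, E.proj (E.edgePath e) := by
    rw [AddSubmonoidClass.coe_finsetSum]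
    rfl
  refine ⟨fun x => ?_, fun x hx => ?_⟩
  · rw [ENNReal.tsum_eq_iSup_sum]
    refine iSup_le fun F => ?_
    have h : 0 ≤ θ (E.diagP x - ∑ e ∈ F.map (Function.Embedding.subtype _),
        E.diagProj (E.edgePath e)) := by
      refine functional_nonneg_of_star_mul_self_eq hθ.1.1 ?_
      rw [AddSubgroupClass.coe_sub, hcoe]
      refine E.star_mul_self_sub_sum_edges x _ fun e he => ?_
      obtain ⟨e, -, rfl⟩ := Finset.mem_map.1 he
      exact e.2
    rw [map_sub, hsum, ← coe_vertexWeight hθ.1.1, sub_nonneg, Complex.real_le_real,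
      Finset.sum_map] at h
    rw [← ENNReal.ofNNReal_finsetSum, ENNReal.coe_le_coe, ← NNReal.coe_le_coe, NNReal.coe_sum]
    exact h
  · have h1 : E.diagP x = ∑ e ∈ hx.1.toFinset, E.diagProj (E.edgePath e) := by
      refine Subtype.ext ?_
      rw [hcoe]
      refine (E.univ.P_eq_sum x hx).trans (Finset.sum_congr rfl fun e _ => ?_)
      rw [proj_edgePath]
    have h2 := coe_vertexWeight hθ.1.1 x
    rw [h1, hsum, Complex.ofReal_inj, ← NNReal.coe_sum, NNReal.coe_inj] at h2
    let _ : Fintype {e // E.r e = x} := hx.1.fintype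
    rw [h2, ENNReal.ofNNReal_finsetSum, tsum_fintype]
    exact (Finset.sum_subtype hx.1.toFinset (fun e => hx.1.mem_toFinset)
      fun e => (vertexWeight θ (E.s e) : ℝ≥0∞)).symm

/-- The bound by one comes from $\theta(q_W)\le\|q_W\|\le 1$. For the converse, Cauchy–Schwarz gives
$|\theta(q_Wa)|^2\le\theta(q_W)\,\theta(a^*a)\le N\|a\|^2$ with $N$ the total mass, and $q_Wa\to a$
yields $1=\|\theta\|\le\sqrt N$. -/
theorem norm1_vertexWeight (hθ : θ ∈ states E.diagonal) : norm1 (vertexWeight θ) = 1 := by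
  have hq := functional_q_eq_sum θ fun x => (coe_vertexWeight hθ.1 x).symm
  have hle (W : Finset V) : ∑ x ∈ W, (vertexWeight θ x : ℝ) ≤ 1 := by
    have h2 := θ.le_opNorm ⟨E.q W, E.q_mem_diagonal W⟩
    rw [hq, Complex.norm_real, hθ.2, one_mul] at h2
    exact (le_abs_self _).trans (h2.trans (E.norm_q_le W))
  have htop : norm1 (vertexWeight θ) ≤ 1 := by simpa using norm1_le_ofReal hle
  have hne : norm1 (vertexWeight θ) ≠ ∞ := ne_top_of_le_ne_top ENNReal.one_ne_top htop
  refine le_antisymm htop ?_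
  set N := (norm1 (vertexWeight θ)).toReal with hN
  have hN0 : 0 ≤ N := ENNReal.toReal_nonneg
  have hqa (W : Finset V) (a : E.diagonal) :
      ‖θ (⟨E.q W, E.q_mem_diagonal W⟩ * a)‖ ^ 2 ≤ N * ‖a‖ ^ 2 := by
    set Q : E.diagonal := ⟨E.q W, E.q_mem_diagonal W⟩ with hQ
    have hstar : star Q = Q := Subtype.ext (E.star_q W)
    have hmul : Q * Q = Q := Subtype.ext (E.q_mul_self W)
    have h := hθ.1.norm_map_star_mul_sq_le Q a
    rw [hstar, hmul] at h
    have h1 : (θ Q).re ≤ N := by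
      rw [hq, Complex.ofReal_re]
      exact sum_le_toReal_norm1 hne W
    have h2 : (θ (star a * a)).re ≤ ‖a‖ ^ 2 := by
      refine (Complex.re_le_norm _).trans ((θ.le_opNorm _).trans_eq ?_)
      rw [hθ.2, one_mul, sq]
      exact CStarRing.norm_star_mul_self (x := (a : E.GraphCStar))
    exact h.trans (mul_le_mul h1 h2 (Complex.nonneg_iff.1 (hθ.1 a)).1 hN0)
  have hbound (a : E.diagonal) : ‖θ a‖ ^ 2 ≤ N * ‖a‖ ^ 2 := by
    have hlim : Tendsto (fun W => (⟨E.q W, E.q_mem_diagonal W⟩ * a : E.diagonal)) atTop (𝓝 a) :=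
      tendsto_subtype_rng.2 (E.tendsto_q_mul a)
    exact le_of_tendsto (((θ.continuous.tendsto a).comp hlim).norm.pow 2)
      (Eventually.of_forall fun W => hqa W a)
  have hnorm : ‖θ‖ ≤ √N := by
    refine θ.opNorm_le_bound (Real.sqrt_nonneg N) fun a => ?_
    refine abs_le_of_sq_le_sq' ?_ (by positivity) |>.2
    rw [mul_pow, Real.sq_sqrt hN0]
    exact hbound a
  rw [hθ.2, Real.one_le_sqrt, hN] at hnorm
  rw [← ENNReal.ofReal_toReal hne]
  exact ENNReal.one_le_ofReal.2 hnorm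

theorem vertexWeight_mem_normalizedGraphTraces (hθ : θ ∈ fullyInvariantStates E.diagonal) :
    vertexWeight θ ∈ E.normalizedGraphTraces :=
  ⟨vertexWeight_mem_graphTraces hθ, norm1_vertexWeight hθ.1⟩

end VertexWeight

/-! ### Convexity -/

theorem tsum_combination {ι : Type w} (g h : V → ℝ≥0) (a b : ℝ≥0) (f : ι → V) :
    ∑' i, (((a • g + b • h) (f i) : ℝ≥0) : ℝ≥0∞) =
      a * ∑' i, (g (f i) : ℝ≥0∞) + b * ∑' i, (h (f i) : ℝ≥0∞) := by
  rw [← ENNReal.tsum_mul_left, ← ENNReal.tsum_mul_left, ← ENNReal.tsum_add]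
  exact tsum_congr fun i => by simp

theorem normalizedGraphTraces_convex {E : DirectedGraph V Ed} {g h : V → ℝ≥0}
    (hg : g ∈ E.normalizedGraphTraces) (hh : h ∈ E.normalizedGraphTraces) {a b : ℝ≥0}
    (hab : a + b = 1) : a • g + b • h ∈ E.normalizedGraphTraces := by
  have key1 (x : V) : (((a • g + b • h) x : ℝ≥0) : ℝ≥0∞) = a * g x + b * h x := by simp
  refine ⟨⟨fun x => ?_, fun x hx => ?_⟩, ?_⟩
  · rw [tsum_combination g h a b fun e : {e // E.r e = x} => E.s e, key1]
    gcongr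
    · exact hg.1.1 x
    · exact hh.1.1 x
  · rw [tsum_combination g h a b fun e : {e // E.r e = x} => E.s e, key1, hg.1.2 x hx, hh.1.2 x hx]
  · rw [norm1, tsum_combination g h a b fun x => x]
    have h1 : ∑' x, (g x : ℝ≥0∞) = 1 := hg.2
    have h2 : ∑' x, (h x : ℝ≥0∞) = 1 := hh.2
    rw [h1, h2, mul_one, mul_one, ← ENNReal.coe_add, hab, ENNReal.coe_one]

end DirectedGraph

end

/-! ### Assembly of the theorem -/

theorem mainTheorem7 {V : Type u} {Ed : Type v} [Countable V] [Countable Ed]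
    (E : DirectedGraph V Ed) :
    -- the functionals `η_g` on `𝒟(E)_fin`, their norms on the corners, and their continuity
    (∀ g ∈ E.graphTraces, ∃ η : E.diagonalFin →ₗ[ℂ] ℂ,
      (IsPositiveFunctional η ∧ ∀ α : E.FinPath, η (E.diagFinProj α) = ((g α.source : ℝ) : ℂ)) ∧
      (∀ η' : E.diagonalFin →ₗ[ℂ] ℂ, IsPositiveFunctional η' →
        (∀ α : E.FinPath, η' (E.diagFinProj α) = ((g α.source : ℝ) : ℂ)) → η' = η) ∧
      (∀ W : Finset V, FunctionalHasNorm (restrictFunctional (E.corner_le_diagonalFin W) η)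
        (∑ x ∈ W, (g x : ℝ))) ∧
      (Continuous η ↔ DirectedGraph.norm1 g ≠ ∞) ∧
      (DirectedGraph.norm1 g ≠ ∞ → FunctionalHasNorm η (DirectedGraph.norm1 g).toReal)) ∧
    -- the states `ψ_g` on `𝒟(E)`
    (∀ g ∈ E.normalizedGraphTraces, ∃! ψ : E.diagonal →L[ℂ] ℂ,
      ψ ∈ states E.diagonal ∧ ∀ α : E.FinPath, ψ (E.diagProj α) = ((g α.source : ℝ) : ℂ)) ∧
    -- `T₁(E)` is convex
    (∀ g ∈ E.normalizedGraphTraces, ∀ h ∈ E.normalizedGraphTraces, ∀ a b : ℝ≥0, a + b = 1 →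
      a • g + b • h ∈ E.normalizedGraphTraces) ∧
    -- `g ↦ ψ_g` is an affine bijection from `T₁(E)` onto `S^inv(𝒟(E))`, with inverse `θ ↦ g^θ`
    ∃ Ψ : E.normalizedGraphTraces ≃ fullyInvariantStates E.diagonal,
      (∀ (g : E.normalizedGraphTraces) (α : E.FinPath),
        (Ψ g : E.diagonal →L[ℂ] ℂ) (E.diagProj α) =
          (((g : V → ℝ≥0) α.source : ℝ) : ℂ)) ∧
      (∀ (g : E.normalizedGraphTraces) (η : E.diagonalFin →ₗ[ℂ] ℂ), IsPositiveFunctional η →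
        (∀ α : E.FinPath, η (E.diagFinProj α) = (((g : V → ℝ≥0) α.source : ℝ) : ℂ)) →
        ∀ a : E.diagonalFin,
          (Ψ g : E.diagonal →L[ℂ] ℂ) ⟨a, E.diagonalFin_le_diagonal a.2⟩ = η a) ∧
      (∀ (g h k : E.normalizedGraphTraces) (a b : ℝ≥0), a + b = 1 →
        (k : V → ℝ≥0) = a • (g : V → ℝ≥0) + b • (h : V → ℝ≥0) →
        (Ψ k : E.diagonal →L[ℂ] ℂ) =
          ((a : ℝ) : ℂ) • (Ψ g : E.diagonal →L[ℂ] ℂ) +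
            ((b : ℝ) : ℂ) • (Ψ h : E.diagonal →L[ℂ] ℂ)) ∧
      (∀ (θ : fullyInvariantStates E.diagonal) (x : V),
        ((((Ψ.symm θ : V → ℝ≥0) x : ℝ≥0) : ℝ) : ℂ) =
          (θ : E.diagonal →L[ℂ] ℂ) (E.diagP x)) := by
  have hT1 (g : E.normalizedGraphTraces) := DirectedGraph.exists_fullyInvariantState g.2
  choose ψ hψ hψα using hT1
  let Ψ : E.normalizedGraphTraces ≃ fullyInvariantStates E.diagonal :=
    { toFun g := ⟨ψ g, hψ g⟩
      invFun θ := ⟨DirectedGraph.vertexWeight θ,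
        DirectedGraph.vertexWeight_mem_normalizedGraphTraces θ.2⟩
      left_inv g := by
        ext x
        have h := DirectedGraph.coe_vertexWeight (hψ g).1.1 x
        rw [← DirectedGraph.diagProj_vertexPath, hψα, Complex.ofReal_inj] at h
        exact h
      right_inv θ := by
        refine Subtype.ext (DirectedGraph.diagonal_functional_ext fun α => ?_)
        rw [DirectedGraph.map_diagProj_eq_vertexWeight θ.2]
        exact hψα _ α }
  refine ⟨fun g hg => ?_, fun g hg => ⟨ψ ⟨g, hg⟩, ⟨(hψ ⟨g, hg⟩).1, hψα ⟨g, hg⟩⟩, ?_⟩,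
    fun g hg h hh a b hab => DirectedGraph.normalizedGraphTraces_convex hg hh hab,
    Ψ, hψα, ?_, ?_, fun θ x => DirectedGraph.coe_vertexWeight θ.2.1.1 x⟩
  · obtain ⟨ω, hω⟩ := DirectedGraph.exists_isTracialFamily hg
    refine ⟨hω.functionalFin, ⟨hω.isPositiveFunctional_functionalFin,
      hω.functionalFin_diagFinProj⟩, fun η' hη' h => ?_, hω.functionalHasNorm_restrict,
      hω.continuous_functionalFin_iff, hω.functionalHasNorm_functionalFin⟩
    refine DirectedGraph.diagonalFin_functional_ext hη' hω.isPositiveFunctional_functionalFin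
      fun α => ?_
    rw [h, hω.functionalFin_diagFinProj]
  · rintro φ ⟨-, hφ⟩
    exact DirectedGraph.diagonal_functional_ext fun α => (hφ α).trans (hψα ⟨g, hg⟩ α).symm
  · intro g η hη hηα a
    -- The restriction of `ψ g` to `E.diagonalFin` is again positive with the prescribed values, so
    -- uniqueness identifies it with `η`.
    have h := DirectedGraph.diagonalFin_functional_ext
      (η := restrictFunctional E.diagonalFin_le_diagonal (ψ g : E.diagonal →ₗ[ℂ] ℂ))
      (fun b => (hψ g).1.1 ⟨b, E.diagonalFin_le_diagonal b.2⟩) hη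
      fun α => (hψα g α).trans (hηα α).symm
    exact LinearMap.congr_fun h a
  · intro g h k a b hab hk
    -- Affinity is read off on path projections, where both sides are affine in the graph trace.
    refine DirectedGraph.diagonal_functional_ext fun α => ?_
    rw [add_apply, smul_apply, smul_apply]
    refine (hψα k α).trans ?_
    change _ = ((a : ℝ) : ℂ) * ψ g (E.diagProj α) + ((b : ℝ) : ℂ) * ψ h (E.diagProj α)
    rw [hψα, hψα, hk]
    simp
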